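/- Let $q$ be a power of $2$, let $V$ be a $6$-dimensional vector space over $\mathbb F_q$, and let $\mathcal W(5,q)$ be the symplectic polar space of ${\rm PG}(5,q)={\rm PG}(V)$ defined by a non-degenerate alternating form $B$; its lines are the lines of ${\rm PG}(5,q)$ that are totally isotropic for $B$. Let $Q$ be a quadratic form on $V$ with polar form $B$, let $N\in V$ with $Q(N)\neq 0$, and let $N^\perp=\{x\in V: B(N,x)=0\}$. Consider the pencil of quadrics consisting of the quadrics $Q(x)+c\,B(N,x)^2=0$ ($c\in\mathbb F_q$) and of the quadric $B(N,x)^2=0$. Its base locus is the parabolic quadric $\mathcal Q(4,q)=\{Q=0\}\cap N^\perp$, which has nucleus $N$; the quadric $B(N,x)^2=0$ is the cone with vertex $N$ over $\mathcal Q(4,q)$, and of the other $q$ quadrics $q/2$ are elliptic and $q/2$ are hyperbolic. Let $\mathcal E_j\ne\mathcal E_k$ be two elliptic quadrics of this pencil. (1) A relative hemisystem of an elliptic quadric $\mathcal E$ of the pencil is a set of $q^2(q^2-1)/2$ points of $\mathcal E\setminus\mathcal Q(4,q)$ that has exactly $q/2$ points in common with each line contained in $\mathcal E$ that meets $\mathcal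 Q(4,q)$ in exactly one point. Let $\mathcal R_j$, $\mathcal R_k$ be relative hemisystems of $\mathcal E_j$, $\mathcal E_k$, and let $\mathcal O_1=\mathcal R_j\cup\mathcal R_k\cup\mathcal Q(4,q)$. Then every line $\ell$ of $\mathcal W(5,q)$ satisfies $$|\ell\cap\mathcal O_1|\in\left\{0,\,1,\,2,\,\tfrac q2+1,\,q+1\right\},$$ and exactly $(q+1)(q^2+1)$ lines of $\mathcal W(5,q)$ are contained in $\mathcal O_1$. (2) Let $q=2^{2h+1}$ with $h>0$, let $\mathcal T$ be a Suzuki–Tits ovoid of $\mathcal Q(4,q)$, and let $Sz(q)$ be the Suzuki group fixing $\mathcal T$, acting on ${\rm PG}(5,q)$ as the derived subgroup of the group of all linear isometries of $Q$ that fix $N$ and stabilise $\mathcal T$. Here a Suzuki–Tits ovoid of $\mathcal Q(4,q)$ is a set which, in suitable coordinates of $N^\perp$ for which $Q|_{N^\perp}=X_0X_3+X_1X_2+X_4^2$, consists of the point $(0,0,0,1,0)$ and of the points $(1,x,y,\,xy+x^{\sigma+2}+y^{\sigma},\,x^{2^h+1}+y^{2^h})$, $x,y\in\mathbb F_q$,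 where $\sigma=2^{h+1}$. Let $A_j$ be an $Sz(q)$-orbit on $\mathcal E_j\setminus\mathcal Q(4,q)$ of size $(q^3-q^2)(q-\sqrt{2q}+1)/2$, let $B_k$ be an $Sz(q)$-orbit on $\mathcal E_k\setminus\mathcal Q(4,q)$ of size $(q^3-q^2)(q+\sqrt{2q}+1)/2$, and let $\mathcal O_2=A_j\cup B_k\cup\mathcal Q(4,q)$. Then every line $\ell$ of $\mathcal W(5,q)$ satisfies $$|\ell\cap\mathcal O_2|\in\left\{0,\,1,\,2,\,\tfrac{q-\sqrt{2q}}2+1,\,\tfrac q2+1,\,\tfrac{q+\sqrt{2q}}2+1,\,q+1\right\},$$ where $|\ell\cap\mathcal O_2|=\frac q2+1$ if and only if $\ell$ is contained in $\mathcal E_j$ or in $\mathcal E_k$ and meets $\mathcal Q(4,q)$ in exactly one point, that point belonging to $\mathcal T$. Exactly $(q+1)(q^2+1)$ lines of $\mathcal W(5,q)$ are contained in $\mathcal O_2$. -/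

import Mathlib

open Module
open scoped LinearAlgebra.Projectivization Pointwise

/-- The points of the projective space `ℙ F V` that lie on the subspace `U`. -/
def pointsOf {F V : Type*} [Field F] [AddCommGroup V] [Module F V]
    (U : Submodule F V) : Set (ℙ F V) :=
  {p | p.submodule ≤ U}

/-- The projective lines of the symplectic polar space of the alternating form `B`: the totally
isotropic subspaces of vector dimension `2`. -/
def IsPolarLine {F V : Type*} [Field F] [AddCommGroup V] [Module F V]
    (B : LinearMap.BilinForm F V) (l : Submodule F V) : Prop :=
  finrank F l = 2 ∧ ∀ x ∈ l, ∀ y ∈ l, B x y = 0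

/-- The set of singular points of a quadratic form. -/
def quadric {F V : Type*} [Field F] [AddCommGroup V] [Module F V]
    (Q : QuadraticForm F V) : Set (ℙ F V) :=
  {p | ∀ x ∈ p.submodule, Q x = 0}

/-- For `V` of dimension `6` over a finite field: `Q` defines an elliptic quadric of `PG(5, q)`,
i.e. `Q` is non-degenerate and its quadric contains no plane of `PG(5, q)` (in characteristic `2`
and even dimension, non-degeneracy of `Q` is non-degeneracy of its polar form). -/
def IsElliptic {F V : Type*} [Field F] [AddCommGroup V] [Module F V]
    (Q : QuadraticForm F V) : Prop :=
  LinearMap.BilinForm.Nondegenerate Q.polarBilin ∧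
    ¬ ∃ U : Submodule F V, finrank F U = 3 ∧ ∀ x ∈ U, Q x = 0

/-- The member `Q + c B(N, ·)²` of the pencil spanned by `Q` and by the double hyperplane
`B(N, ·)² = 0`, where `B` is the polar form of `Q`. If `Q N ≠ 0`, then `Q` restricts to a parabolic
quadric with nucleus `N` on the hyperplane `N^⊥ : B(N, ·) = 0`, and each point of `N^⊥` is on
a line joining `N` to that parabolic quadric; so the quadric `B(N, ·)² = 0` is the cone with vertex
`N` over it. In characteristic `2` all the forms `Q + c B(N, ·)²` have the polar form `B`. -/
noncomputable def pencilForm {F V : Type*} [Field F] [AddCommGroup V] [Module F V]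
    (Q : QuadraticForm F V) (N : V) (c : F) : QuadraticForm F V :=
  Q + c • QuadraticMap.linMulLin (Q.polarBilin N) (Q.polarBilin N)

/-- The base locus of the pencil: the parabolic quadric `Q(4, q)` cut out by `Q` on `N^⊥`. -/
def baseLocus {F V : Type*} [Field F] [AddCommGroup V] [Module F V]
    (Q : QuadraticForm F V) (N : V) : Set (ℙ F V) :=
  quadric Q ∩ pointsOf (LinearMap.ker (Q.polarBilin N))

/-- `R` is a relative hemisystem of the quadric `E` with respect to the subset `P` of `E` (used for
an elliptic quadric `E` of the pencil and for `P = Q(4, q)`), where `q = |F|`. -/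
def IsRelativeHemisystem {F V : Type*} [Field F] [AddCommGroup V] [Module F V]
    (E P R : Set (ℙ F V)) : Prop :=
  R ⊆ E \ P ∧ 2 * R.ncard = Nat.card F ^ 2 * (Nat.card F ^ 2 - 1) ∧
    ∀ l : Submodule F V, finrank F l = 2 → pointsOf l ⊆ E → (pointsOf l ∩ P).ncard = 1 →
      2 * (pointsOf l ∩ R).ncard = Nat.card F

/-- Coordinates of the Suzuki-Tits ovoid of the parabolic quadric `X₀X₃ + X₁X₂ + X₄² = 0` of
`PG(4, q)`, `q = 2 ^ (2 h + 1)`. With `σ : x ↦ x ^ 2 ^ (h + 1)`, so that `σ² : x ↦ x ^ 2`, its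
projection from the nucleus `(0, 0, 0, 0, 1)` is the Tits ovoid of `PG(3, q)` with the points
`(0, 0, 0, 1)` and `(1, x, y, xy + x ^ (σ + 2) + y ^ σ)`; the last coordinate below is the square
root of `x ^ (σ + 2) + y ^ σ`. -/
def titsCoords (F : Type*) [Field F] (h : ℕ) : Set (Fin 5 → F) :=
  {![0, 0, 0, 1, 0]} ∪
    {v | ∃ x y : F, v = ![1, x, y, x * y + x ^ (2 ^ (h + 1) + 2) + y ^ 2 ^ (h + 1),
      x ^ (2 ^ h + 1) + y ^ 2 ^ h]}

/-- `T` is a Suzuki-Tits ovoid of the parabolic quadric cut out by `Q` on the hyperplane `N^⊥`: in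
suitable coordinates of `N^⊥` the quadric is `X₀X₃ + X₁X₂ + X₄² = 0` and `T` is as above. -/
def IsSuzukiTitsOvoid {F V : Type*} [Field F] [AddCommGroup V] [Module F V]
    (h : ℕ) (Q : QuadraticForm F V) (N : V) (T : Set (ℙ F V)) : Prop :=
  ∃ e : Fin 5 → V, (∀ i, Q.polarBilin N (e i) = 0) ∧
    (∀ x : Fin 5 → F, Q (∑ i, x i • e i) = x 0 * x 3 + x 1 * x 2 + x 4 ^ 2) ∧
    T = {p | ∃ x ∈ titsCoords F h, p.submodule = Submodule.span F {∑ i, x i • e i}}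

/-- The group of linear isometries of `Q`. -/
def isometryGroup {F V : Type*} [Field F] [AddCommGroup V] [Module F V]
    (Q : QuadraticForm F V) : Subgroup (V ≃ₗ[F] V) where
  carrier := {g | ∀ x, Q (g x) = Q x}
  mul_mem' := by
    intro a b ha hb x
    exact (ha (b x)).trans (hb x)
  one_mem' := fun _ => rfl
  inv_mem' := by
    intro a ha x
    have h1 := ha (a⁻¹ x)
    have h2 : a (a⁻¹ x) = x := a.apply_symm_apply x
    rw [h2] at h1
    exact h1.symm

/-- The isometries of `Q` that fix the vector `N` and stabilise the point set `T`. They stabilise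
every quadric of the pencil. -/
def ovoidStabilizer {F V : Type*} [Field F] [AddCommGroup V] [Module F V]
    (Q : QuadraticForm F V) (N : V) (T : Set (ℙ F V)) : Subgroup (V ≃ₗ[F] V) :=
  isometryGroup Q ⊓ MulAction.stabilizer (V ≃ₗ[F] V) N ⊓ MulAction.stabilizer (V ≃ₗ[F] V) T

/-- The Suzuki group `Sz(q)` of the Suzuki-Tits ovoid `T`, acting on the whole of `V`. The group
induced by `ovoidStabilizer Q N T` on `N^⊥` is the full group `Sz(q)` of projectivities of `Q(4, q)`
stabilising `T`, and the kernel of this restriction is the group of order `2` generated by the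
transvection with centre `N`; hence `ovoidStabilizer Q N T = Sz(q) × 2`, and `Sz(q)`, which
is perfect for `q > 2`, is its derived subgroup. -/
def suzukiGroup {F V : Type*} [Field F] [AddCommGroup V] [Module F V]
    (Q : QuadraticForm F V) (N : V) (T : Set (ℙ F V)) : Subgroup (V ≃ₗ[F] V) :=
  ⁅ovoidStabilizer Q N T, ovoidStabilizer Q N T⁆

/-- `A` is an orbit of the group `G` on the point set `X`. -/
def IsOrbitOn {F V : Type*} [Field F] [AddCommGroup V] [Module F V]
    (G : Subgroup (V ≃ₗ[F] V)) (X A : Set (ℙ F V)) : Prop :=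
  ∃ p ∈ X, A = MulAction.orbit G p

/-! In characteristic 2 all forms Q + c B(N,·)² have the same polar form B. On a totally isotropic
line each of them is therefore additive with Q(ax) = a²Q(x), and since squaring is bijective the
line lies in the quadric or meets it in exactly one point (`polarLine_subset_or_tangent`). Two
quadrics of the pencil meet only in Q(4,q). So an isotropic line lies in Q(4,q), or lies in neither
elliptic quadric and has at most two points in the union, or lies in exactly one of them; in the
last case it meets Q(4,q) in one point and has one point more than it has in the chosen subset of
that quadric (`polarLine_inter_cases`). This settles (1). A line inside the union has q + 1 ≥ 3
points there and is forced into Q(4,q), whose lines are counted by `ncard_singular_lines`.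

For (2) it remains to find how many points k an orbit A has on a line of E that meets N^⊥ only in a
point P. Call the degree of a point x of E off N^⊥ the number of t in T orthogonal to x. The counts
in `IsElliptic.ncard_affine` fix the first two moments of the degree. The group is transitive on T
and on A, so the degree is a constant n on A, and every t is orthogonal to the same number of points
of A. Put s² = 2q, so that q² + 1 = (q+1-s)(q+1+s). For |A| = (q-1)q²(q+1-s)/2, double counting and
coprimality give n = m(q+1+s) with 0 ≤ m ≤ 2. The second moment excludes m = 0 and m = 2, and then
forces degree q+1-s off A (`incidenceDegree_eq_of_tactical`).

On the other hand, the degrees along the line add up to q² + q if P is in T and to q² - q otherwise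
(`IsOvoidFamily.sum_incidenceDegree_line`); the absence of planes in E enters here. Comparing
k(q+1+s) + (q-k)(q+1-s) with this sum gives k = q/2 or k = (q-s)/2. The orbit of the other size is
the case of -s.

Transitivity of the derived group on T (`IsSuzukiTitsOvoid.exists_smul_eq`) is shown with explicit
matrices: commutators of one diagonal element with translations already carry the origin to every
affine point of T. -/

/-! ### Quadratic forms in characteristic 2 -/

section CharTwoForms

variable {F V : Type*} [Field F] [AddCommGroup V] [Module F V]

theorem exists_sq_eq_of_charTwo [Finite F] [CharP F 2] (a : F) : ∃ b : F, b ^ 2 = a := by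
  obtain ⟨b, hb⟩ := FiniteField.isSquare_of_char_two (ringChar.eq F 2) a
  exact ⟨b, by rw [hb, sq]⟩

theorem polarBilin_comm (Q : QuadraticForm F V) (x y : V) :
    Q.polarBilin x y = Q.polarBilin y x :=
  QuadraticMap.polar_comm _ _ _

theorem map_add_polarBilin (Q : QuadraticForm F V) (x y : V) :
    Q (x + y) = Q x + Q y + Q.polarBilin x y :=
  QuadraticMap.map_add _ _ _

theorem polarBilin_self [CharP F 2] (Q : QuadraticForm F V) (x : V) : Q.polarBilin x x = 0 := by
  have h : Q.polarBilin x x = 2 • Q x := QuadraticMap.polar_self Q x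
  rw [h, two_smul, CharTwo.add_self_eq_zero]

theorem map_smul_form (Q : QuadraticForm F V) (a : F) (x : V) : Q (a • x) = a ^ 2 * Q x := by
  rw [QuadraticMap.map_smul, sq, smul_eq_mul]

theorem polarBilin_eq_zero_of_mem_span {Q : QuadraticForm F V} {s : Set V} {x y : V}
    (hs : ∀ z ∈ s, Q.polarBilin z y = 0) (hx : x ∈ Submodule.span F s) :
    Q.polarBilin x y = 0 := by
  induction hx using Submodule.span_induction with
  | mem z hz => exact hs z hz
  | zero => simp
  | add a b _ _ ha hb => rw [map_add, LinearMap.add_apply, ha, hb, add_zero]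
  | smul a z _ hz => rw [map_smul, LinearMap.smul_apply, hz, smul_zero]

/-- On N^⊥ one has Q(z + aN) = Q(z) + a²Q(N), and every element of F is a square. Translating by N
is thus a way to make a vector singular without changing its products with vectors of N^⊥. -/
theorem exists_add_smul_singular [Finite F] [CharP F 2] {Q : QuadraticForm F V} {N : V}
    (hN : Q N ≠ 0) {z : V} (hz : Q.polarBilin N z = 0) : ∃ a : F, Q (z + a • N) = 0 := by
  obtain ⟨a, ha⟩ := exists_sq_eq_of_charTwo (Q z / Q N)
  refine ⟨a, ?_⟩
  rw [map_add_polarBilin, map_smul_form, ha, map_smul, polarBilin_comm, hz, div_mul_cancel₀ _ hN,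
    smul_zero, add_zero, CharTwo.add_self_eq_zero]

/-- Otherwise B(p,·) vanishes on the kernel of B(N,·), hence is a multiple of it, and non-degeneracy
makes p a multiple of N. -/
theorem exists_polarBilin_eq_zero_one {Q : QuadraticForm F V} (hB : Q.polarBilin.Nondegenerate)
    {N p : V} (hp : p ∉ Submodule.span F {N}) :
    ∃ z, Q.polarBilin N z = 0 ∧ Q.polarBilin p z = 1 := by
  by_contra! h
  have h1 : ∀ z, Q.polarBilin N z = 0 → Q.polarBilin p z = 0 := by
    intro z hz
    by_contra h2
    exact h ((Q.polarBilin p z)⁻¹ • z) (by rw [map_smul, hz, smul_zero])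
      (by rw [map_smul, smul_eq_mul, inv_mul_cancel₀ h2])
  have h2 : Q.polarBilin p ∈ Submodule.span F (Set.range fun _ : Unit => Q.polarBilin N) :=
    mem_span_of_iInf_ker_le_ker (by simpa [SetLike.le_def] using h1)
  rw [Set.range_const, Submodule.mem_span_singleton] at h2
  obtain ⟨a, ha⟩ := h2
  refine hp (Submodule.mem_span_singleton.2 ⟨a, ?_⟩)
  rw [← sub_eq_zero]
  refine hB.1 _ fun y => ?_
  rw [map_sub, map_smul, ha, sub_self, LinearMap.zero_apply]

/-- The vectors orthogonal to `k` linearly independent vectors. -/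
theorem ncard_orthogonal [Finite F] [Module.Finite F V] {Q : QuadraticForm F V}
    (hB : Q.polarBilin.Nondegenerate) {k : ℕ} {v : Fin k → V} (hv : LinearIndependent F v) :
    {x | ∀ i, Q.polarBilin (v i) x = 0}.ncard = Nat.card F ^ (finrank F V - k) := by
  have h1 := LinearMap.BilinForm.finrank_orthogonal hB (Submodule.span F (Set.range v))
  rw [finrank_span_eq_card hv, Fintype.card_fin] at h1
  rw [← h1, ← Module.natCard_eq_pow_finrank, ← Nat.card_coe_set_eq]
  refine Nat.card_congr (Equiv.subtypeEquivRight fun x => ?_)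
  rw [Set.mem_ofPred_eq, LinearMap.BilinForm.mem_orthogonal_iff]
  refine ⟨fun h y hy => ?_, fun h i => h _ (Submodule.subset_span ⟨i, rfl⟩)⟩
  refine polarBilin_eq_zero_of_mem_span (s := Set.range v) ?_ hy
  rintro _ ⟨i, rfl⟩
  exact h i

/-- A subspace of `N^⊥` through `N` is swept out by the translates of its singular vectors by the
multiples of `N`. -/
theorem ncard_singular_mul [Finite F] [CharP F 2] {Q : QuadraticForm F V} {N : V} (hN : Q N ≠ 0)
    {S : Set V} (hS : ∀ x ∈ S, Q.polarBilin N x = 0) (hSN : ∀ x ∈ S, ∀ a : F, x + a • N ∈ S) :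
    {x ∈ S | Q x = 0}.ncard * Nat.card F = S.ncard := by
  rw [← Nat.card_coe_set_eq, ← Nat.card_coe_set_eq, ← Nat.card_prod]
  -- Since a ↦ a² is a bijection of F, each coset of the multiples of N in S contains exactly one
  -- singular vector.
  have key : ∀ x ∈ S, ∀ a : F, Q (x + a • N) = Q x + a ^ 2 * Q N := by
    intro x hx a
    rw [map_add_polarBilin, map_smul_form, map_smul, polarBilin_comm, hS x hx, smul_zero, add_zero]
  refine Nat.card_congr (Equiv.ofBijective
    (fun z : {x ∈ S | Q x = 0} × F => (⟨z.1.1 + z.2 • N, hSN _ z.1.2.1 _⟩ : S)) ⟨?_, ?_⟩)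
  · rintro ⟨⟨x, hx, hx0⟩, a⟩ ⟨⟨y, hy, hy0⟩, b⟩ h
    simp only [Subtype.mk.injEq] at h
    have h1 := key x hx a
    rw [h, key y hy b, hx0, hy0, zero_add, zero_add] at h1
    have h2 := CharTwo.sq_inj.1 (mul_right_cancel₀ hN h1)
    subst h2
    simpa using h
  · rintro ⟨y, hy⟩
    obtain ⟨a, ha⟩ := exists_add_smul_singular hN (hS y hy)
    refine ⟨(⟨y + a • N, hSN y hy a, ha⟩, -a), ?_⟩
    simp

end CharTwoForms

/-! ### Points, lines and quadrics of the projective space -/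

section Points

variable {F V : Type*} [Field F] [AddCommGroup V] [Module F V]

theorem mk_mem_pointsOf {U : Submodule F V} {x : V} (hx : x ≠ 0) :
    Projectivization.mk F x hx ∈ pointsOf U ↔ x ∈ U := by
  change (Projectivization.mk F x hx).submodule ≤ U ↔ _
  rw [Projectivization.submodule_mk, Submodule.span_singleton_le_iff_mem]

theorem mem_pointsOf_iff_rep {U : Submodule F V} {p : ℙ F V} : p ∈ pointsOf U ↔ p.rep ∈ U := by
  conv_lhs => rw [← p.mk_rep]
  exact mk_mem_pointsOf _

theorem mk_mem_quadric {Q : QuadraticForm F V} {x : V} (hx : x ≠ 0) :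
    Projectivization.mk F x hx ∈ quadric Q ↔ Q x = 0 := by
  change (∀ y ∈ (Projectivization.mk F x hx).submodule, Q y = 0) ↔ _
  rw [Projectivization.submodule_mk]
  refine ⟨fun h => h x (Submodule.mem_span_singleton_self x), fun h y hy => ?_⟩
  obtain ⟨a, rfl⟩ := Submodule.mem_span_singleton.1 hy
  rw [map_smul_form, h, mul_zero]

theorem mem_quadric_iff_rep {Q : QuadraticForm F V} {p : ℙ F V} : p ∈ quadric Q ↔ Q p.rep = 0 := by
  conv_lhs => rw [← p.mk_rep]
  exact mk_mem_quadric _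

theorem ncard_pointsOf (U : Submodule F V) : (pointsOf U).ncard = Nat.card (ℙ F U) := by
  rw [← Nat.card_coe_set_eq]
  symm
  refine Nat.card_congr (Equiv.ofBijective
    (fun p : ℙ F U => (⟨p.map U.subtype U.subtype_injective, ?_⟩ : pointsOf U)) ⟨?_, ?_⟩)
  · induction p using Projectivization.ind with
    | h x hx => exact (mk_mem_pointsOf _).2 x.2
  · intro p p' h
    exact Projectivization.map_injective U.subtype U.subtype_injective (congrArg Subtype.val h)
  · rintro ⟨p, hp⟩
    have h0 : (⟨p.rep, mem_pointsOf_iff_rep.1 hp⟩ : U) ≠ 0 := fun h =>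
      p.rep_nonzero (congrArg Subtype.val h)
    refine ⟨Projectivization.mk F _ h0, Subtype.ext ?_⟩
    exact p.mk_rep

theorem ncard_pointsOf_of_finrank_two [Finite F] {U : Submodule F V} (hU : finrank F U = 2) :
    (pointsOf U).ncard = Nat.card F + 1 := by
  rw [ncard_pointsOf, Projectivization.card_of_finrank_two F U hU]

theorem ncard_pointsOf_of_finrank_one [Finite F] {U : Submodule F V} (hU : finrank F U = 1) :
    (pointsOf U).ncard = 1 := by
  rw [ncard_pointsOf, Projectivization.card_of_finrank F U hU, Finset.sum_range_one, pow_zero]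

theorem pointsOf_subset_iff {U W : Submodule F V} : pointsOf U ⊆ pointsOf W ↔ U ≤ W := by
  refine ⟨fun h x hx => ?_, fun h p hp => le_trans hp h⟩
  by_cases h0 : x = 0
  · rw [h0]; exact W.zero_mem
  · exact (mk_mem_pointsOf h0).1 (h ((mk_mem_pointsOf h0).2 hx))

theorem pointsOf_subset_quadric_iff {U : Submodule F V} {Q : QuadraticForm F V} :
    pointsOf U ⊆ quadric Q ↔ ∀ x ∈ U, Q x = 0 := by
  refine ⟨fun h x hx => ?_, fun h p hp => mem_quadric_iff_rep.2 (h _ (mem_pointsOf_iff_rep.1 hp))⟩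
  by_cases h0 : x = 0
  · rw [h0, QuadraticMap.map_zero]
  · exact (mk_mem_quadric h0).1 (h ((mk_mem_pointsOf h0).2 hx))

/-- A totally isotropic line is contained in a quadric or tangent to it. -/
theorem polarLine_subset_or_tangent [Finite F] [CharP F 2] {Q : QuadraticForm F V}
    {l : Submodule F V} (hl : IsPolarLine Q.polarBilin l) :
    pointsOf l ⊆ quadric Q ∨ (pointsOf l ∩ quadric Q).ncard = 1 := by
  have hfin : Module.Finite F l := Module.finite_of_finrank_pos (by rw [hl.1]; norm_num)
  -- The singular vectors of the line form a subspace because the polar form vanishes on the line.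
  let K : Submodule F V :=
    { carrier := {x | x ∈ l ∧ Q x = 0}
      zero_mem' := ⟨l.zero_mem, Q.map_zero⟩
      add_mem' := fun {x y} hx hy => ⟨l.add_mem hx.1 hy.1, by
        rw [map_add_polarBilin, hx.2, hy.2, hl.2 x hx.1 y hy.1, add_zero, add_zero]⟩
      smul_mem' := fun a x hx => ⟨l.smul_mem a hx.1, by
        rw [map_smul_form, hx.2, mul_zero]⟩ }
  have hKl : K ≤ l := fun x hx => hx.1
  have hKp : pointsOf l ∩ quadric Q = pointsOf K := by
    ext p
    rw [Set.mem_inter_iff, mem_pointsOf_iff_rep, mem_quadric_iff_rep, mem_pointsOf_iff_rep]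
    rfl
  by_cases hall : ∀ x ∈ l, Q x = 0
  · exact Or.inl (pointsOf_subset_quadric_iff.2 hall)
  right
  push Not at hall
  obtain ⟨x, hx, hQx⟩ := hall
  -- For y on the line and a² = Q(y)/Q(x), the vector y - ax is singular. So K has codimension at
  -- most 1.
  have hsup : l ≤ K ⊔ Submodule.span F {x} := by
    intro y hy
    obtain ⟨a, ha⟩ := exists_sq_eq_of_charTwo (Q y / Q x)
    refine Submodule.mem_sup.2 ⟨y - a • x, ⟨l.sub_mem hy (l.smul_mem a hx), ?_⟩, a • x,
      Submodule.smul_mem _ _ (Submodule.mem_span_singleton_self x), sub_add_cancel _ _⟩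
    rw [sub_eq_add_neg, map_add_polarBilin, QuadraticMap.map_neg, map_smul_form, ha,
      div_mul_cancel₀ _ hQx, hl.2 y hy _ (l.neg_mem (l.smul_mem a hx)), add_zero,
      CharTwo.add_self_eq_zero]
  have hlt : K < l := lt_of_le_of_ne hKl fun h => hQx ((h.symm ▸ hx : x ∈ K).2)
  have h1 : finrank F K < 2 := by
    have := Submodule.finrank_lt_finrank_of_lt hlt
    rwa [hl.1] at this
  have hKfin : Module.Finite F K := Submodule.finiteDimensional_of_le hKl
  have h2 : finrank F l ≤ finrank F K + 1 := by
    have := Submodule.finrank_mono hsup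
    have h3 := Submodule.finrank_add_le_finrank_add_finrank K (Submodule.span F {x})
    have h4 : finrank F (Submodule.span F {x}) = 1 :=
      finrank_span_singleton fun h => hQx (by rw [h, Q.map_zero])
    omega
  rw [hl.1] at h2
  rw [hKp, ncard_pointsOf_of_finrank_one (by omega)]

/-- Points off a hyperplane correspond to the vectors on which its equation takes the value `1`. -/
theorem exists_mk_of_notMem_ker {f : Dual F V} {p : ℙ F V}
    (hp : p ∉ pointsOf (LinearMap.ker f)) :
    ∃ (x : V) (hx : x ≠ 0), f x = 1 ∧ Projectivization.mk F x hx = p := by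
  have h1 : f p.rep ≠ 0 := fun h => hp (mem_pointsOf_iff_rep.2 h)
  have h2 : (f p.rep)⁻¹ ≠ 0 := inv_ne_zero h1
  refine ⟨(f p.rep)⁻¹ • p.rep, smul_ne_zero h2 p.rep_nonzero, ?_, ?_⟩
  · rw [map_smul, smul_eq_mul, inv_mul_cancel₀ h1]
  · conv_rhs => rw [← p.mk_rep]
    rw [Projectivization.mk_eq_mk_iff']
    exact ⟨_, rfl⟩

theorem mk_inj_of_apply_eq_one {f : Dual F V} {x y : V} {hx : x ≠ 0} {hy : y ≠ 0}
    (hfx : f x = 1) (hfy : f y = 1)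
    (h : Projectivization.mk F x hx = Projectivization.mk F y hy) : x = y := by
  obtain ⟨a, ha⟩ := (Projectivization.mk_eq_mk_iff' F x y hx hy).1 h
  have h1 : a = 1 := by
    have := congrArg f ha
    rwa [map_smul, hfx, hfy, smul_eq_mul, mul_one] at this
  rw [← ha, h1, one_smul]

end Points

/-! ### The number of lines of Q(4,q) -/

section SingularLines

variable {F V : Type*} [Field F] [AddCommGroup V] [Module F V]

/-- The lines of the parabolic quadric of `N^⊥`. -/
theorem ncard_singular_lines [Finite F] [CharP F 2] (hV : finrank F V = 6)
    {Q : QuadraticForm F V} (hB : Q.polarBilin.Nondegenerate) {N : V} (hN : Q N ≠ 0) :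
    {l : Submodule F V | IsPolarLine Q.polarBilin l ∧
      ∀ x ∈ l, Q x = 0 ∧ Q.polarBilin N x = 0}.ncard =
      (Nat.card F + 1) * (Nat.card F ^ 2 + 1) := by
  classical
  have hfin : Module.Finite F V := Module.finite_of_finrank_pos (by rw [hV]; norm_num)
  have hfinV : Finite V := Module.finite_of_finite F
  have hN0 : N ≠ 0 := fun h => hN (by rw [h, Q.map_zero])
  set q := Nat.card F with hq
  have hq1 : 1 < q := Finite.one_lt_card
  set f := Q.polarBilin N with hf
  have hfN : f N = 0 := polarBilin_self Q N
  -- The lines are counted through their ordered bases: pairs of independent, orthogonal, singular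
  -- vectors of N^⊥. There are q⁴ - 1 choices for the first vector and q³ - q for the second, and
  -- every line has (q² - 1)(q² - q) bases.
  let X : Set V := {x | x ≠ 0 ∧ f x = 0 ∧ Q x = 0}
  have hX : X.ncard + 1 = q ^ 4 := by
    have h1 : {x | ∀ i, Q.polarBilin ((![N] : Fin 1 → V) i) x = 0}.ncard = q ^ (6 - 1) := by
      rw [ncard_orthogonal hB (by simpa using hN0), hV]
    have h2 := ncard_singular_mul (Q := Q) hN
      (S := {x | ∀ i, Q.polarBilin ((![N] : Fin 1 → V) i) x = 0})
      (fun x hx => hx 0) (fun x hx a i => by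
        rw [map_add, map_smul, hx i]
        fin_cases i
        simp only [Fin.zero_eta, Matrix.cons_val_zero]
        rw [← hf, hfN, smul_zero, add_zero])
    rw [h1] at h2
    have h3 : {x ∈ {x | ∀ i, Q.polarBilin ((![N] : Fin 1 → V) i) x = 0} | Q x = 0}.ncard = q ^ 4 :=
      Nat.eq_of_mul_eq_mul_right (by omega : 0 < q) (by rw [h2]; ring)
    rw [← h3, ← Set.ncard_insert_of_notMem (a := (0 : V)) (s := X) (fun h => h.1 rfl)]
    congr 1
    ext x
    simp only [X, Set.mem_insert_iff, Set.mem_ofPred_eq, Fin.forall_fin_one, Matrix.cons_val_zero]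
    by_cases hx : x = 0
    · simp [hx]
    · simp [hx, hf]
  let Y : V → Set V := fun x =>
    {y | f y = 0 ∧ Q y = 0 ∧ Q.polarBilin x y = 0 ∧ y ∉ Submodule.span F {x}}
  have hY : ∀ x ∈ X, (Y x).ncard + q = q ^ 3 := by
    rintro x ⟨hx0, hfx, hQx⟩
    -- N is not singular, so it is no multiple of x; hence x and N impose two independent conditions
    -- on y, leaving q⁴ vectors, one in q of them singular.
    have hNx : LinearIndependent F ![x, N] := by
      rw [LinearIndependent.pair_iff' hx0]
      rintro a rfl
      exact hN (by rw [map_smul_form, hQx, mul_zero])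
    have h1 : {y | ∀ i, Q.polarBilin ((![x, N] : Fin 2 → V) i) y = 0}.ncard = q ^ (6 - 2) := by
      rw [ncard_orthogonal hB hNx, hV]
    have h2 := ncard_singular_mul (Q := Q) hN
      (S := {y | ∀ i, Q.polarBilin ((![x, N] : Fin 2 → V) i) y = 0})
      (fun y hy => hy 1) (fun y hy a i => by
        rw [map_add, map_smul, hy i]
        fin_cases i
        · simp only [Fin.zero_eta, Matrix.cons_val_zero]
          rw [polarBilin_comm, ← hf, hfx, smul_zero, add_zero]
        · simp only [Fin.mk_one, Matrix.cons_val_one, Matrix.cons_val_fin_one]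
          rw [← hf, hfN, smul_zero, add_zero])
    rw [h1] at h2
    have h3 : {y ∈ {y | ∀ i, Q.polarBilin ((![x, N] : Fin 2 → V) i) y = 0} | Q y = 0}.ncard
        = q ^ 3 :=
      Nat.eq_of_mul_eq_mul_right (by omega : 0 < q) (by rw [h2]; ring)
    have h4 : ((Submodule.span F {x} : Submodule F V) : Set V).ncard = q := by
      have := Module.natCard_eq_pow_finrank (K := F) (V := Submodule.span F {x})
      rw [finrank_span_singleton hx0, pow_one] at this
      exact (Nat.card_coe_set_eq _).symm.trans this
    have h5 : Disjoint (Y x) (Submodule.span F {x} : Submodule F V) :=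
      Set.disjoint_left.2 fun y hy => hy.2.2.2
    rw [← h3]
    conv_lhs => rw [← h4]
    rw [← Set.ncard_union_eq h5 (Set.toFinite _) (Set.toFinite _)]
    congr 1
    ext y
    simp only [Y, Set.mem_union, Set.mem_ofPred_eq, Fin.forall_fin_two, Matrix.cons_val_zero,
      Matrix.cons_val_one, Matrix.cons_val_fin_one, SetLike.mem_coe]
    by_cases hy : y ∈ Submodule.span F {x}
    · obtain ⟨a, rfl⟩ := Submodule.mem_span_singleton.1 hy
      simp only [hy, or_true, true_iff, map_smul, map_smul_form, hQx, polarBilin_self, smul_zero,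
        mul_zero, true_and, and_true]
      rw [← hf, hfx, smul_zero]
    · simp only [hy, hf]
      tauto
  let P : Set (Fin 2 → V) := {s | LinearIndependent F s ∧ (∀ i, f (s i) = 0 ∧ Q (s i) = 0) ∧
    Q.polarBilin (s 0) (s 1) = 0}
  have hP : P.ncard = (q ^ 4 - 1) * (q ^ 3 - q) := by
    have e : Nat.card P = Nat.card (Σ x : X, Y x) := by
      symm
      refine Nat.card_congr (Equiv.ofBijective
        (fun z => (⟨![z.1.1, z.2.1], ?_, ?_, ?_⟩ : P)) ⟨?_, ?_⟩)
      · rw [LinearIndependent.pair_iff' z.1.2.1]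
        intro a ha
        exact z.2.2.2.2.2 (Submodule.mem_span_singleton.2 ⟨a, ha⟩)
      · rw [Fin.forall_fin_two]
        exact ⟨z.1.2.2, z.2.2.1, z.2.2.2.1⟩
      · exact z.2.2.2.2.1
      · rintro ⟨⟨x, hx⟩, ⟨y, hy⟩⟩ ⟨⟨x', hx'⟩, ⟨y', hy'⟩⟩ h
        have h1 := congrArg Subtype.val h
        have h2 : x = x' := congrFun h1 0
        have h3 : y = y' := congrFun h1 1
        subst h2 h3
        rfl
      · rintro ⟨s, hs, h1, h2⟩
        have hs' : LinearIndependent F ![s 0, s 1] := by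
          convert! hs using 1
          ext i
          fin_cases i <;> rfl
        have h0 : s 0 ≠ 0 := hs.ne_zero 0
        refine ⟨⟨⟨s 0, h0, h1 0⟩, ⟨s 1, (h1 1).1, (h1 1).2, h2, fun h => ?_⟩⟩, ?_⟩
        · obtain ⟨a, ha⟩ := Submodule.mem_span_singleton.1 h
          exact (LinearIndependent.pair_iff' h0).1 hs' a ha
        · refine Subtype.ext (funext fun i => ?_)
          fin_cases i <;> rfl
    rw [← Nat.card_coe_set_eq, e]
    have := Fintype.ofFinite X
    rw [Nat.card_sigma, Finset.sum_congr rfl (g := fun _ => q ^ 3 - q), Finset.sum_const,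
      Finset.card_univ, ← Nat.card_eq_fintype_card, Nat.card_coe_set_eq, smul_eq_mul]
    · congr 1
      omega
    · intro x _
      have := hY x.1 x.2
      rw [Nat.card_coe_set_eq]
      omega
  set L := {l : Submodule F V | IsPolarLine Q.polarBilin l ∧ ∀ x ∈ l, Q x = 0 ∧ f x = 0} with hL
  have hPL : P.ncard = L.ncard * ((q ^ 2 - 1) * (q ^ 2 - q)) := by
    have e : Nat.card P = Nat.card (Σ l : L, {s : Fin 2 → l.1 // LinearIndependent F s}) := by
      symm
      refine Nat.card_congr (Equiv.ofBijective
        (fun z => (⟨fun i => (z.2.1 i : V), ?_, ?_, ?_⟩ : P)) ⟨?_, ?_⟩)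
      · exact z.2.2.map' z.1.1.subtype (Submodule.ker_subtype _)
      · exact fun i => (z.1.2.2 _ (z.2.1 i).2).symm
      · exact z.1.2.1.2 _ (z.2.1 0).2 _ (z.2.1 1).2
      -- A line is recovered as the span of any of its bases, so no pair is counted for two lines.
      · have hspan : ∀ (l : L) (s : {s : Fin 2 → l.1 // LinearIndependent F s}),
            Submodule.span F (Set.range fun i => (s.1 i : V)) = l.1 := by
          intro l s
          apply Submodule.eq_of_le_of_finrank_eq
          · rw [Submodule.span_le]
            rintro _ ⟨i, rfl⟩
            exact (s.1 i).2
          · rw [l.2.1.1]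
            exact finrank_span_eq_card (s.2.map' l.1.subtype (Submodule.ker_subtype _))
        rintro ⟨l, s⟩ ⟨l', s'⟩ h
        have h1 : (fun i => (s.1 i : V)) = fun i => (s'.1 i : V) := congrArg Subtype.val h
        have h2 : l = l' := Subtype.ext (by rw [← hspan l s, h1, hspan l' s'])
        subst h2
        have h3 : s = s' := Subtype.ext (funext fun i => Subtype.ext (congrFun h1 i))
        rw [h3]
      · rintro ⟨s, hs, h1, h2⟩
        have hall : ∀ x ∈ Submodule.span F (Set.range s), ∃ a b : F, x = a • s 0 + b • s 1 := by
          intro x hx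
          obtain ⟨c, hc⟩ := (Submodule.mem_span_range_iff_exists_fun F).1 hx
          exact ⟨c 0, c 1, by rw [← hc, Fin.sum_univ_two]⟩
        have h2' : Q.polarBilin (s 1) (s 0) = 0 := by rw [polarBilin_comm, h2]
        refine ⟨⟨⟨Submodule.span F (Set.range s), ⟨?_, ?_⟩, ?_⟩,
          ⟨fun i => ⟨s i, Submodule.subset_span ⟨i, rfl⟩⟩, ?_⟩⟩, rfl⟩
        · rw [finrank_span_eq_card hs, Fintype.card_fin]
        · intro x hx y hy
          obtain ⟨a, b, rfl⟩ := hall x hx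
          obtain ⟨c, d, rfl⟩ := hall y hy
          simp only [map_add, map_smul, LinearMap.add_apply, LinearMap.smul_apply, polarBilin_self,
            h2, h2', smul_zero, add_zero]
        · intro x hx
          obtain ⟨a, b, rfl⟩ := hall x hx
          constructor
          · rw [map_add_polarBilin, map_smul_form, map_smul_form, (h1 0).2, (h1 1).2, map_smul,
              map_smul, LinearMap.smul_apply, h2]
            simp
          · rw [map_add, map_smul, map_smul, (h1 0).1, (h1 1).1]
            simp
        · exact LinearIndependent.of_comp (Submodule.span F (Set.range s)).subtype hs
    rw [← Nat.card_coe_set_eq, e]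
    have := Fintype.ofFinite L
    have := Fintype.ofFinite F
    rw [Nat.card_sigma, Finset.sum_congr rfl (g := fun _ => (q ^ 2 - 1) * (q ^ 2 - q)),
      Finset.sum_const, Finset.card_univ, ← Nat.card_eq_fintype_card, Nat.card_coe_set_eq,
      smul_eq_mul]
    intro l _
    rw [card_linearIndependent (by rw [l.2.1.1]), l.2.1.1, Fin.prod_univ_two,
      ← Nat.card_eq_fintype_card, ← hq]
    simp
  rw [hP] at hPL
  have h2 : q < q ^ 2 := by nlinarith
  have h3 : q < q ^ 3 := by nlinarith
  have h4 : 1 < q ^ 4 := by nlinarith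
  zify [h2.le, h3.le, h4.le, (by omega : 1 ≤ q ^ 2)] at hPL ⊢
  have hne : ((q : ℤ) ^ 2 - 1) * ((q : ℤ) ^ 2 - q) ≠ 0 := by
    have : (1 : ℤ) < q := by exact_mod_cast hq1
    have h5 : (0 : ℤ) < (q : ℤ) ^ 2 - 1 := by nlinarith
    have h6 : (0 : ℤ) < (q : ℤ) ^ 2 - q := by nlinarith
    positivity
  apply mul_right_cancel₀ hne
  rw [← hPL]
  ring

end SingularLines

/-! ### Solutions of bc = φ(e) and ad + bc = φ(e) with φ free of zeros -/

section TupleCounts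

variable {F : Type*} [Field F]

theorem ncard_mul_eq {φ : F → F} (hφ : ∀ e, φ e ≠ 0) :
    {z : F × F × F | z.1 * z.2.1 = φ z.2.2}.ncard = (Nat.card F - 1) * Nat.card F := by
  rw [← Nat.card_units, ← Nat.card_prod, ← Nat.card_coe_set_eq]
  refine Nat.card_congr
    { toFun := fun z => (Units.mk0 z.1.1 fun h => hφ z.1.2.2 (by rw [← z.2, h, zero_mul]), z.1.2.2)
      invFun := fun z => ⟨(z.1, (z.1 : F)⁻¹ * φ z.2, z.2), by simp⟩
      left_inv := ?_
      right_inv := ?_ }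
  · rintro ⟨⟨b, c, e⟩, h⟩
    have hb : b ≠ 0 := fun h0 => hφ e (by rw [← h, h0, zero_mul])
    have h' : b * c = φ e := h
    simp [← h', hb]
  · rintro ⟨b, e⟩
    ext <;> simp

/-- A nonzero a determines d from the other variables; a = 0 leaves d free and reduces to the
equation bc = φ(e). -/
theorem ncard_mul_add_mul_eq [Finite F] {φ : F → F} (hφ : ∀ e, φ e ≠ 0) :
    {z : F × F × F × F × F | z.1 * z.2.1 + z.2.2.1 * z.2.2.2.1 = φ z.2.2.2.2}.ncard =
      (Nat.card F - 1) * Nat.card F ^ 2 * (Nat.card F + 1) := by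
  have e : {z : F × F × F × F × F | z.1 * z.2.1 + z.2.2.1 * z.2.2.2.1 = φ z.2.2.2.2} ≃
      (Fˣ × F × F × F) ⊕ (F × {z : F × F × F | z.1 * z.2.1 = φ z.2.2}) := by
    classical
    refine
      { toFun := fun z => if h : z.1.1 = 0 then
          Sum.inr (z.1.2.1, ⟨z.1.2.2, by
            have h2 : z.1.1 * z.1.2.1 + z.1.2.2.1 * z.1.2.2.2.1 = φ z.1.2.2.2.2 := z.2
            rw [h, zero_mul, zero_add] at h2
            exact h2⟩)
          else Sum.inl (Units.mk0 z.1.1 h, z.1.2.2)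
        invFun := Sum.elim
          (fun z => ⟨(z.1, (z.1 : F)⁻¹ * (φ z.2.2.2 - z.2.1 * z.2.2.1), z.2), by simp⟩)
          (fun z => ⟨(0, z.1, z.2.1), by
            have h2 : z.2.1.1 * z.2.1.2.1 = φ z.2.1.2.2 := z.2.2
            simp [h2]⟩)
        left_inv := ?_
        right_inv := ?_ }
    · rintro ⟨⟨a, d, b, c, e⟩, h⟩
      have h' : a * d + b * c = φ e := h
      by_cases ha : a = 0
      · simp [ha]
      · simp [ha, ← h']
    · rintro (⟨a, b, c, e⟩ | ⟨d, ⟨⟨b, c, e⟩, h⟩⟩)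
      · simp
      · simp
  rw [← Nat.card_coe_set_eq, Nat.card_congr e, Nat.card_sum, Nat.card_prod, Nat.card_prod,
    Nat.card_prod, Nat.card_prod, Nat.card_coe_set_eq, ncard_mul_eq hφ,
    Nat.card_units]
  ring

end TupleCounts

/-! ### Counting the points of an elliptic quadric off N^⊥ -/

section EllipticCounts

variable {F V : Type*} [Field F] [AddCommGroup V] [Module F V]

theorem linearIndependent_triple {x y z : V}
    (h : ∀ a b c : F, a • x + b • y + c • z = 0 → a = 0 ∧ b = 0 ∧ c = 0) :
    LinearIndependent F ![x, y, z] := by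
  rw [Fintype.linearIndependent_iff]
  intro g hg
  rw [Fin.sum_univ_three] at hg
  obtain ⟨h0, h1, h2⟩ := h _ _ _ hg
  intro i
  fin_cases i <;> assumption

/-- What separates elliptic from hyperbolic quadrics, the absence of planes, is used only in this
form. -/
theorem IsElliptic.not_totally_singular {Q : QuadraticForm F V} (hQ : IsElliptic Q) {x y z : V}
    (hli : LinearIndependent F ![x, y, z]) (hx : Q x = 0) (hy : Q y = 0) (hz : Q z = 0)
    (hxy : Q.polarBilin x y = 0) (hxz : Q.polarBilin x z = 0) (hyz : Q.polarBilin y z = 0) :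
    False := by
  refine hQ.2 ⟨Submodule.span F (Set.range ![x, y, z]), by
    rw [finrank_span_eq_card hli, Fintype.card_fin], fun w hw => ?_⟩
  obtain ⟨c, rfl⟩ := (Submodule.mem_span_range_iff_exists_fun F).1 hw
  simp [Fin.sum_univ_three, map_add_polarBilin, map_smul_form, hx, hy, hz, hxy, hxz, hyz,
    -QuadraticMap.polarBilin_apply_apply]

/-- The complement of t, t', N has q³ vectors, more than the q multiples of N, so it contains some z
outside the span of N. A translate of z by N is the singular vector p. A partner of p is projected
off the plane of t and t' and made singular in the same way. -/
theorem exists_hyperbolic_pair_of_pair [Finite F] [CharP F 2] (hV : finrank F V = 6)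
    {Q : QuadraticForm F V} (hB : Q.polarBilin.Nondegenerate) {N : V} (hN : Q N ≠ 0) {t t' : V}
    (hNt : Q.polarBilin N t = 0) (hNt' : Q.polarBilin N t' = 0) (htt' : Q.polarBilin t t' = 1) :
    ∃ p p' : V, Q p = 0 ∧ Q p' = 0 ∧ Q.polarBilin N p = 0 ∧ Q.polarBilin N p' = 0 ∧
      Q.polarBilin t p = 0 ∧ Q.polarBilin t' p = 0 ∧ Q.polarBilin t p' = 0 ∧
      Q.polarBilin t' p' = 0 ∧ Q.polarBilin p p' = 1 := by
  have hfin : Module.Finite F V := Module.finite_of_finrank_pos (by rw [hV]; norm_num)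
  have hfinV : Finite V := Module.finite_of_finite F
  have hN0 : N ≠ 0 := fun h => hN (by rw [h, Q.map_zero])
  have ht't : Q.polarBilin t' t = 1 := by rw [polarBilin_comm, htt']
  have htN : Q.polarBilin t N = 0 := by rw [polarBilin_comm, hNt]
  have ht'N : Q.polarBilin t' N = 0 := by rw [polarBilin_comm, hNt']
  have hli : LinearIndependent F ![t, t', N] := by
    refine linearIndependent_triple fun a b c h => ?_
    have ha := congrArg (Q.polarBilin t') h
    have hb := congrArg (Q.polarBilin t) h
    simp only [map_add, map_smul, map_zero, polarBilin_self, htt', ht't, htN, ht'N, smul_eq_mul,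
      mul_zero, mul_one, add_zero, zero_add] at ha hb
    subst ha hb
    simpa [hN0] using h
  have hcard : {x | ∀ i, Q.polarBilin ((![t, t', N] : Fin 3 → V) i) x = 0}.ncard =
      Nat.card F ^ (6 - 3) := by rw [ncard_orthogonal hB hli, hV]
  have hspan : ((Submodule.span F {N} : Submodule F V) : Set V).ncard = Nat.card F := by
    have := Module.natCard_eq_pow_finrank (K := F) (V := Submodule.span F {N})
    rw [finrank_span_singleton hN0, pow_one] at this
    exact (Nat.card_coe_set_eq _).symm.trans this
  have hq1 : 1 < Nat.card F := Finite.one_lt_card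
  obtain ⟨z, hz, hzN⟩ : ∃ z ∈ {x | ∀ i, Q.polarBilin ((![t, t', N] : Fin 3 → V) i) x = 0},
      z ∉ ((Submodule.span F {N} : Submodule F V) : Set V) := by
    refine Set.exists_mem_notMem_of_ncard_lt_ncard ?_ (Set.toFinite _)
    rw [hcard, hspan]
    nlinarith [Nat.pow_lt_pow_right hq1 (by norm_num : 1 < 6 - 3)]
  have hzt : Q.polarBilin t z = 0 := hz 0
  have hzt' : Q.polarBilin t' z = 0 := hz 1
  have hNz : Q.polarBilin N z = 0 := hz 2
  obtain ⟨a, ha⟩ := exists_add_smul_singular hN hNz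
  set p := z + a • N with hp
  have hNp : Q.polarBilin N p = 0 := by
    rw [hp, map_add, map_smul, hNz, polarBilin_self, smul_zero, add_zero]
  have htp : Q.polarBilin t p = 0 := by
    rw [hp, map_add, map_smul, hzt, htN, smul_zero, add_zero]
  have ht'p : Q.polarBilin t' p = 0 := by
    rw [hp, map_add, map_smul, hzt', ht'N, smul_zero, add_zero]
  have hpt : Q.polarBilin p t = 0 := by rw [polarBilin_comm, htp]
  have hpt' : Q.polarBilin p t' = 0 := by rw [polarBilin_comm, ht'p]
  have hpN : Q.polarBilin p N = 0 := by rw [polarBilin_comm, hNp]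
  have hpspan : p ∉ Submodule.span F {N} := fun h => hzN (by
    have := Submodule.sub_mem _ h
      (Submodule.smul_mem _ a (Submodule.mem_span_singleton_self (R := F) N))
    rwa [hp, add_sub_cancel_right] at this)
  obtain ⟨w, hNw, hpw⟩ := exists_polarBilin_eq_zero_one hB hpspan
  -- The projection of w to the complement of the hyperbolic plane of t and t'; as p is orthogonal
  -- to that plane, B(p, w') is still 1.
  set w' := w - Q.polarBilin t' w • t - Q.polarBilin t w • t' with hw'
  have hNw' : Q.polarBilin N w' = 0 := by
    simp only [hw', map_sub, map_smul, hNw, hNt, hNt', smul_zero, sub_zero]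
  have htw' : Q.polarBilin t w' = 0 := by
    simp only [hw', map_sub, map_smul, polarBilin_self, htt', smul_eq_mul, mul_zero, mul_one,
      sub_zero, sub_self]
  have ht'w' : Q.polarBilin t' w' = 0 := by
    simp only [hw', map_sub, map_smul, polarBilin_self, ht't, smul_eq_mul, mul_zero, mul_one,
      sub_self]
  have hpw' : Q.polarBilin p w' = 1 := by
    simp only [hw', map_sub, map_smul, hpw, hpt, hpt', smul_zero, sub_zero]
  obtain ⟨b, hb⟩ := exists_add_smul_singular hN hNw'
  refine ⟨p, w' + b • N, ha, hb, hNp, ?_, htp, ht'p, ?_, ?_, ?_⟩ <;>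
    simp only [map_add, map_smul, hNw', htw', ht'w', hpw', polarBilin_self, htN, ht'N, hpN,
      smul_zero, add_zero]

/-- Coordinates on the affine hyperplane `B(N, ·) = 1` in which `Q` is
`a d + b c` up to an anisotropic part. -/
theorem IsElliptic.exists_coordinates [Finite F] [CharP F 2] (hV : finrank F V = 6)
    {Q : QuadraticForm F V} (hQ : IsElliptic Q) {N : V} (hN : Q N ≠ 0) {t t' : V}
    (ht : Q t = 0) (ht' : Q t' = 0) (hNt : Q.polarBilin N t = 0) (hNt' : Q.polarBilin N t' = 0)
    (htt' : Q.polarBilin t t' = 1) :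
    ∃ (φ : F → F) (Φ : F × F × F × F × F → V), (∀ e, φ e ≠ 0) ∧ Function.Injective Φ ∧
      Set.range Φ = {x | Q.polarBilin N x = 1} ∧
      ∀ z, (Q (Φ z) = 0 ↔ z.1 * z.2.1 + z.2.2.1 * z.2.2.2.1 = φ z.2.2.2.2) ∧
        Q.polarBilin (Φ z) t = z.1 ∧ Q.polarBilin (Φ z) t' = z.2.1 := by
  have hB := hQ.1
  have hfin : Module.Finite F V := Module.finite_of_finrank_pos (by rw [hV]; norm_num)
  have hfinV : Finite V := Module.finite_of_finite F
  have hN0 : N ≠ 0 := fun h => hN (by rw [h, Q.map_zero])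
  obtain ⟨p, p', hp, hp', hNp, hNp', htp, ht'p, htp', ht'p', hpp'⟩ :=
    exists_hyperbolic_pair_of_pair hV hB hN hNt hNt' htt'
  obtain ⟨u₀, hu₀⟩ : ∃ u, Q.polarBilin N u = 1 := by
    by_contra! h
    refine hN0 (hB.1 N fun y => ?_)
    by_contra hy
    exact h ((Q.polarBilin N y)⁻¹ • y) (by rw [map_smul, smul_eq_mul, inv_mul_cancel₀ hy])
  have ht't : Q.polarBilin t' t = 1 := by rw [polarBilin_comm, htt']
  have hp'p : Q.polarBilin p' p = 1 := by rw [polarBilin_comm, hpp']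
  have hpt : Q.polarBilin p t = 0 := by rw [polarBilin_comm, htp]
  have hpt' : Q.polarBilin p t' = 0 := by rw [polarBilin_comm, ht'p]
  have hp't : Q.polarBilin p' t = 0 := by rw [polarBilin_comm, htp']
  have hp't' : Q.polarBilin p' t' = 0 := by rw [polarBilin_comm, ht'p']
  have htN : Q.polarBilin t N = 0 := by rw [polarBilin_comm, hNt]
  have ht'N : Q.polarBilin t' N = 0 := by rw [polarBilin_comm, hNt']
  have hpN : Q.polarBilin p N = 0 := by rw [polarBilin_comm, hNp]
  have hp'N : Q.polarBilin p' N = 0 := by rw [polarBilin_comm, hNp']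
  obtain ⟨u, hNu, htu, ht'u, hpu, hp'u⟩ : ∃ u, Q.polarBilin N u = 1 ∧ Q.polarBilin t u = 0 ∧
      Q.polarBilin t' u = 0 ∧ Q.polarBilin p u = 0 ∧ Q.polarBilin p' u = 0 := by
    refine ⟨u₀ - Q.polarBilin t' u₀ • t - Q.polarBilin t u₀ • t' - Q.polarBilin p' u₀ • p -
      Q.polarBilin p u₀ • p', ?_, ?_, ?_, ?_, ?_⟩ <;>
    simp only [map_sub, map_smul, polarBilin_self, hu₀, htt', ht't, hpp', hp'p, hpt, hpt', hp't,
      hp't', htp, htp', ht'p, ht'p', hNt, hNt', hNp, hNp', smul_eq_mul, mul_zero, mul_one, sub_zero,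
      sub_self]
  have hut : Q.polarBilin u t = 0 := by rw [polarBilin_comm, htu]
  have hut' : Q.polarBilin u t' = 0 := by rw [polarBilin_comm, ht'u]
  have hup : Q.polarBilin u p = 0 := by rw [polarBilin_comm, hpu]
  have hup' : Q.polarBilin u p' = 0 := by rw [polarBilin_comm, hp'u]
  -- The vectors u + eN are the part of the affine hyperplane B(N,·) = 1 orthogonal to both
  -- hyperbolic pairs. Off this part Q contributes only ad + bc.
  let ψ : F → V := fun e => u + e • N
  let Φ : F × F × F × F × F → V := fun z =>
    ψ z.2.2.2.2 + (z.1 • t' + z.2.1 • t + z.2.2.1 • p + z.2.2.2.1 • p')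
  have hψ : ∀ e, Q.polarBilin N (ψ e) = 1 ∧ Q.polarBilin t (ψ e) = 0 ∧
      Q.polarBilin t' (ψ e) = 0 ∧ Q.polarBilin p (ψ e) = 0 ∧ Q.polarBilin p' (ψ e) = 0 := by
    intro e
    simp only [ψ, map_add, map_smul, polarBilin_self, hNu, htu, ht'u, hpu, hp'u, htN, ht'N, hpN,
      hp'N, smul_zero, add_zero, and_self]
  have hΦN : ∀ z, Q.polarBilin N (Φ z) = 1 := by
    intro z
    simp only [Φ, map_add, map_smul, (hψ _).1, hNt, hNt', hNp, hNp', smul_zero, add_zero]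
  have hΦt : ∀ z, Q.polarBilin t (Φ z) = z.1 := by
    intro z
    simp only [Φ, map_add, map_smul, (hψ _).2.1, htt', htp, htp', polarBilin_self, smul_eq_mul,
      mul_zero, mul_one, zero_add, add_zero]
  have hΦt' : ∀ z, Q.polarBilin t' (Φ z) = z.2.1 := by
    intro z
    simp only [Φ, map_add, map_smul, (hψ _).2.2.1, ht't, ht'p, ht'p', polarBilin_self, smul_eq_mul,
      mul_zero, mul_one, zero_add, add_zero]
  have hΦp : ∀ z, Q.polarBilin p (Φ z) = z.2.2.2.1 := by
    intro z
    simp only [Φ, map_add, map_smul, (hψ _).2.2.2.1, hpt, hpt', hpp', polarBilin_self, smul_eq_mul,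
      mul_zero, mul_one, zero_add, add_zero]
  have hΦp' : ∀ z, Q.polarBilin p' (Φ z) = z.2.2.1 := by
    intro z
    simp only [Φ, map_add, map_smul, (hψ _).2.2.2.2, hp't, hp't', hp'p, polarBilin_self,
      smul_eq_mul, mul_zero, mul_one, zero_add, add_zero]
  have hinj : Function.Injective Φ := by
    rintro ⟨a, d, b, c, e⟩ ⟨a', d', b', c', e'⟩ h
    have h1 := hΦt (a, d, b, c, e)
    have h2 := hΦt' (a, d, b, c, e)
    have h3 := hΦp (a, d, b, c, e)
    have h4 := hΦp' (a, d, b, c, e)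
    rw [h, hΦt] at h1
    rw [h, hΦt'] at h2
    rw [h, hΦp] at h3
    rw [h, hΦp'] at h4
    simp only at h1 h2 h3 h4
    subst h1 h2 h3 h4
    have h5 : e • N = e' • N := by simpa [Φ, ψ] using h
    rw [smul_left_injective F hN0 h5]
  refine ⟨fun e => Q (ψ e), Φ, ?_, hinj, ?_, ?_⟩
  · intro e he
    obtain ⟨h1, h2, h3, h4, h5⟩ := hψ e
    -- If u + eN were singular, then t, p and u + eN would span a plane of the quadric.
    refine hQ.not_totally_singular (x := t) (y := p) (z := ψ e) ?_ ht hp he htp h2 h4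
    refine linearIndependent_triple fun a b c h => ?_
    have ha := congrArg (Q.polarBilin t') h
    have hb := congrArg (Q.polarBilin p') h
    have hc := congrArg (Q.polarBilin N) h
    simp only [map_add, map_smul, map_zero, h1, h3, h5, ht't, ht'p, hp't, hp'p, hNt, hNp,
      smul_eq_mul, mul_zero, mul_one, add_zero, zero_add] at ha hb hc
    exact ⟨ha, hb, hc⟩
  -- Surjectivity by counting: both sides have q⁵ elements, the hyperplane being a translate of N^⊥.
  · refine Set.eq_of_subset_of_ncard_le ?_ ?_ (Set.toFinite _)
    · rintro _ ⟨z, rfl⟩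
      exact hΦN z
    · have h1 : {x | Q.polarBilin N x = 1} = (fun x => u + x) ''
          {x | ∀ i, Q.polarBilin ((![N] : Fin 1 → V) i) x = 0} := by
        ext x
        constructor
        · intro hx
          refine ⟨x - u, fun i => ?_, add_sub_cancel _ _⟩
          fin_cases i
          have hx' : Q.polarBilin N x = 1 := hx
          simp only [Fin.zero_eta, Matrix.cons_val_zero]
          rw [map_sub, hx', hNu, sub_self]
        · rintro ⟨y, hy, rfl⟩
          have hy0 : Q.polarBilin N y = 0 := hy 0
          change Q.polarBilin N (u + y) = 1
          rw [map_add, hNu, hy0, add_zero]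
      rw [h1, Set.ncard_image_of_injective _ (add_right_injective u),
        ncard_orthogonal hB (by simpa using hN0), hV, ← Set.image_univ,
        Set.ncard_image_of_injective _ hinj, Set.ncard_univ]
      simp only [Nat.card_prod]
      exact le_of_eq (by ring)
  · intro z
    refine ⟨?_, ?_, ?_⟩
    · have h1 : Q (Φ z) = Q (ψ z.2.2.2.2) + (z.1 * z.2.1 + z.2.2.1 * z.2.2.2.1) := by
        obtain ⟨h1, h2, h3, h4, h5⟩ := hψ z.2.2.2.2
        rw [polarBilin_comm] at h2 h3 h4 h5
        simp only [Φ, map_add_polarBilin, map_add, map_smul, map_smul_form, LinearMap.add_apply,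
          LinearMap.smul_apply, h2, h3, h4, h5, ht, ht', hp, hp', ht't, ht'p, ht'p', htp, htp',
          hpp', smul_eq_mul]
        ring
      rw [h1, ← CharTwo.sub_eq_add, sub_eq_zero, eq_comm]
    · rw [polarBilin_comm, hΦt]
    · rw [polarBilin_comm, hΦt']

/-- The points off `N^⊥` of an elliptic quadric, those orthogonal to a given singular point of
`N^⊥`, and those orthogonal to two such points that are not orthogonal to each other. -/
theorem IsElliptic.ncard_affine [Finite F] [CharP F 2] (hV : finrank F V = 6)
    {Q : QuadraticForm F V} (hQ : IsElliptic Q) {N : V} (hN : Q N ≠ 0) {t t' : V}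
    (ht : Q t = 0) (ht' : Q t' = 0) (hNt : Q.polarBilin N t = 0) (hNt' : Q.polarBilin N t' = 0)
    (htt' : Q.polarBilin t t' ≠ 0) :
    {x | Q.polarBilin N x = 1 ∧ Q x = 0}.ncard =
        (Nat.card F - 1) * Nat.card F ^ 2 * (Nat.card F + 1) ∧
      {x | (Q.polarBilin N x = 1 ∧ Q x = 0) ∧ Q.polarBilin x t = 0}.ncard =
        (Nat.card F - 1) * Nat.card F ^ 2 ∧
      {x | (Q.polarBilin N x = 1 ∧ Q x = 0) ∧ Q.polarBilin x t = 0 ∧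
        Q.polarBilin x t' = 0}.ncard = (Nat.card F - 1) * Nat.card F := by
  obtain ⟨φ, Φ, hφ, hinj, hrange, hΦ⟩ := hQ.exists_coordinates hV hN (t := t)
    (t' := (Q.polarBilin t t')⁻¹ • t') ht (by rw [map_smul_form, ht', mul_zero]) hNt
    (by rw [map_smul, hNt', smul_zero]) (by rw [map_smul, smul_eq_mul, inv_mul_cancel₀ htt'])
  have hx : ∀ x, Q.polarBilin N x = 1 ↔ ∃ z, Φ z = x := fun x => by
    rw [← Set.mem_range, hrange]; rfl
  have ht'0 : ∀ x, Q.polarBilin x t' = 0 ↔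
      Q.polarBilin x ((Q.polarBilin t t')⁻¹ • t') = 0 := by
    intro x
    rw [map_smul, smul_eq_mul, mul_eq_zero, or_iff_right (inv_ne_zero htt')]
  refine ⟨?_, ?_, ?_⟩
  · rw [← ncard_mul_add_mul_eq hφ, ← Set.ncard_image_of_injective _ hinj]
    congr 1
    ext x
    constructor
    · rintro ⟨h1, h2⟩
      obtain ⟨z, rfl⟩ := (hx x).1 h1
      exact ⟨z, (hΦ z).1.1 h2, rfl⟩
    · rintro ⟨z, h, rfl⟩
      exact ⟨(hx _).2 ⟨z, rfl⟩, (hΦ z).1.2 h⟩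
  · have hinj' : Function.Injective
        fun z : F × F × F × F => Φ (0, z.1, z.2.1, z.2.2.1, z.2.2.2) :=
      fun z w h => by simpa [Prod.ext_iff] using hinj h
    have h1 : (Set.univ ×ˢ {z : F × F × F | z.1 * z.2.1 = φ z.2.2} : Set (F × F × F × F)).ncard =
        (Nat.card F - 1) * Nat.card F ^ 2 := by
      rw [Set.ncard_prod, Set.ncard_univ, ncard_mul_eq hφ]
      ring
    rw [← h1, ← Set.ncard_image_of_injective _ hinj']
    congr 1
    ext x
    constructor
    · rintro ⟨⟨h1, h2⟩, h3⟩
      obtain ⟨⟨a, d, b, c, e⟩, rfl⟩ := (hx x).1 h1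
      rw [(hΦ _).2.1] at h3
      simp only at h3
      subst h3
      have h4 := (hΦ _).1.1 h2
      exact ⟨(d, b, c, e), ⟨trivial, by simpa using h4⟩, rfl⟩
    · rintro ⟨⟨d, b, c, e⟩, ⟨-, h⟩, rfl⟩
      have h' : b * c = φ e := h
      exact ⟨⟨(hx _).2 ⟨_, rfl⟩, (hΦ _).1.2 (by simpa using h')⟩, (hΦ _).2.1⟩
  · have hinj' : Function.Injective
        fun z : F × F × F => Φ (0, 0, z.1, z.2.1, z.2.2) :=
      fun z w h => by simpa [Prod.ext_iff] using hinj h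
    rw [← ncard_mul_eq hφ, ← Set.ncard_image_of_injective _ hinj']
    congr 1
    ext x
    constructor
    · rintro ⟨⟨h1, h2⟩, h3, h4⟩
      obtain ⟨⟨a, d, b, c, e⟩, rfl⟩ := (hx x).1 h1
      rw [(hΦ _).2.1] at h3
      rw [ht'0, (hΦ _).2.2] at h4
      simp only at h3 h4
      subst h3 h4
      have h5 := (hΦ _).1.1 h2
      exact ⟨(b, c, e), by simpa using h5, rfl⟩
    · rintro ⟨⟨b, c, e⟩, h, rfl⟩
      have h' : b * c = φ e := h
      refine ⟨⟨(hx _).2 ⟨_, rfl⟩, (hΦ _).1.2 (by simpa using h')⟩, (hΦ _).2.1, ?_⟩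
      rw [ht'0, (hΦ _).2.2]

end EllipticCounts

/-! ### Moments of degrees in an incidence structure -/

section Incidence

variable {α ι : Type*} [Fintype ι]

open Classical in
/-- The number of blocks incident with `x`. -/
noncomputable def incidenceDegree (R : ι → α → Prop) (x : α) : ℕ :=
  (Finset.univ.filter fun i => R i x).card

open Classical in
theorem sum_incidenceDegree (R : ι → α → Prop) (S : Finset α) :
    ∑ x ∈ S, incidenceDegree R x = ∑ i, (S.filter (R i)).card := by
  simp only [incidenceDegree, Finset.card_filter]
  exact Finset.sum_comm

-- The square of the degree counts ordered pairs of blocks incident with x, the diagonal included.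
open Classical in
theorem sum_sq_incidenceDegree (R : ι → α → Prop) (S : Finset α) :
    ∑ x ∈ S, incidenceDegree R x ^ 2 =
      ∑ i, ∑ j, (S.filter fun x => R i x ∧ R j x).card := by
  simp only [incidenceDegree, Finset.card_filter, sq, Finset.sum_mul_sum]
  rw [Finset.sum_comm]
  refine Finset.sum_congr rfl fun i _ => ?_
  rw [Finset.sum_comm]
  refine Finset.sum_congr rfl fun j _ => Finset.sum_congr rfl fun x _ => ?_
  by_cases h1 : R i x <;> by_cases h2 : R j x <;> simp [h1, h2]

open Classical in
/-- The second moment of the degrees of a family in which points are on equally many blocks and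
pairs of blocks are on equally many points. -/
theorem sum_sq_incidenceDegree_sub {R : ι → α → Prop} {S : Finset α} {c₁ c₂ : ℕ}
    (h1 : ∀ i, (S.filter (R i)).card = c₁)
    (h2 : ∀ i j, i ≠ j → (S.filter fun x => R i x ∧ R j x).card = c₂) (a : ℤ) :
    ∑ x ∈ S, ((incidenceDegree R x : ℤ) - a) ^ 2 =
      Fintype.card ι * c₁ + Fintype.card ι * (Fintype.card ι - 1) * c₂ -
        2 * a * (Fintype.card ι * c₁) + a ^ 2 * S.card := by
  have hs1 : ∑ x ∈ S, (incidenceDegree R x : ℤ) = Fintype.card ι * c₁ := by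
    have := sum_incidenceDegree R S
    rw [Finset.sum_congr rfl fun i _ => h1 i, Finset.sum_const, Finset.card_univ,
      smul_eq_mul] at this
    exact_mod_cast this
  have hs2 : ∑ x ∈ S, (incidenceDegree R x : ℤ) ^ 2 =
      Fintype.card ι * c₁ + Fintype.card ι * (Fintype.card ι - 1) * c₂ := by
    have h3 : ∀ i : ι, ∑ j, ((S.filter fun x => R i x ∧ R j x).card : ℤ) =
        c₁ + (Fintype.card ι - 1) * c₂ := by
      intro i
      rw [← Finset.add_sum_erase _ _ (Finset.mem_univ i),
        Finset.sum_congr rfl (g := fun _ => (c₂ : ℤ)), Finset.sum_const,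
        Finset.card_erase_of_mem (Finset.mem_univ i), Finset.card_univ]
      · have h4 : 1 ≤ Fintype.card ι := Fintype.card_pos_iff.2 ⟨i⟩
        simp only [and_self, h1]
        rw [nsmul_eq_mul, Nat.cast_sub h4, Nat.cast_one]
      · intro j hj
        rw [h2 i j (Finset.ne_of_mem_erase hj).symm]
    have := sum_sq_incidenceDegree R S
    have h5 : ∑ x ∈ S, (incidenceDegree R x : ℤ) ^ 2 =
        ∑ i, ∑ j, ((S.filter fun x => R i x ∧ R j x).card : ℤ) := by exact_mod_cast this
    rw [h5, Finset.sum_congr rfl fun i _ => h3 i, Finset.sum_const, Finset.card_univ, nsmul_eq_mul]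
    ring
  have : ∀ x ∈ S, ((incidenceDegree R x : ℤ) - a) ^ 2 =
      (incidenceDegree R x : ℤ) ^ 2 - 2 * a * incidenceDegree R x + a ^ 2 := fun x _ => by ring
  rw [Finset.sum_congr rfl this, Finset.sum_add_distrib, Finset.sum_sub_distrib, ← Finset.mul_sum,
    hs1, hs2, Finset.sum_const, nsmul_eq_mul]
  ring

/-- This is what rules out a class of degree zero. The lower bound on q is essential: for q = s = 2
the inequality would read 8 < 3. -/
theorem four_mul_lt_of_sq_eq {q s : ℤ} (hq : 8 ≤ q) (hs : s ^ 2 = 2 * q) :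
    4 * q < (q + 1 - s) * (q + 1) := by
  rcases le_or_gt s 0 with h | h
  · nlinarith
  · have h4 : 4 ≤ s := by nlinarith
    have h5 : (0 : ℤ) ≤ (s - 4) * s ^ 3 := mul_nonneg (by omega) (by positivity)
    nlinarith

open Classical in
/-- Degrees in an incidence structure with the parameters of the points off `N^⊥` of an elliptic
quadric and of an ovoid of the parabolic quadric in `N^⊥`, for a tactical decomposition into two
classes of the given sizes. -/
theorem incidenceDegree_eq_of_tactical {R : ι → α → Prop} {X A : Finset α} {q d n : ℕ} {s : ℤ}
    (hq : 8 ≤ q) (hq2 : Even q) (hs : s ^ 2 = 2 * q) (hι : Fintype.card ι = q ^ 2 + 1)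
    (hX : X.card = (q - 1) * q ^ 2 * (q + 1))
    (h1 : ∀ i, (X.filter (R i)).card = (q - 1) * q ^ 2)
    (h2 : ∀ i j, i ≠ j → (X.filter fun x => R i x ∧ R j x).card = (q - 1) * q)
    (hAX : A ⊆ X) (hA : 2 * (A.card : ℤ) = (q - 1) * q ^ 2 * (q + 1 - s))
    (hn : ∀ x ∈ A, incidenceDegree R x = n) (hd : ∀ i, (A.filter (R i)).card = d) :
    (∀ x ∈ A, (incidenceDegree R x : ℤ) = q + 1 + s) ∧
      ∀ x ∈ X, x ∉ A → (incidenceDegree R x : ℤ) = q + 1 - s := by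
  have hq' : (8 : ℤ) ≤ q := by exact_mod_cast hq
  have hX' : (X.card : ℤ) = (q - 1) * q ^ 2 * (q + 1) := by
    rw [hX]; push_cast [Nat.cast_sub (by omega : 1 ≤ q)]; ring
  have hsum := sum_incidenceDegree R A
  rw [Finset.sum_congr rfl hn, Finset.sum_congr rfl fun i _ => hd i, Finset.sum_const,
    Finset.sum_const, Finset.card_univ, hι, smul_eq_mul, smul_eq_mul] at hsum
  have hsum' : (A.card : ℤ) * n = (q ^ 2 + 1) * d := by exact_mod_cast hsum
  -- The factorisation of the ovoid size over the integers, which links it to the size of A. The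
  -- sign of s is left open so that both orbit sizes are covered.
  have hprod : ((q : ℤ) + 1 - s) * (q + 1 + s) = q ^ 2 + 1 := by linear_combination -hs
  have hne : (q : ℤ) + 1 - s ≠ 0 := fun h => by
    rw [h, zero_mul] at hprod; nlinarith
  have hpos : 0 < (q : ℤ) + 1 + s := by
    have : |s| < |(q : ℤ) + 1| := sq_lt_sq.1 (by rw [hs]; nlinarith)
    rw [abs_of_pos (by omega : (0 : ℤ) < q + 1)] at this
    have := (abs_lt.1 this).1
    omega
  have hK : (0 : ℤ) < (q - 1) * q ^ 2 := by
    have : (0 : ℤ) < (q : ℤ) - 1 := by omega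
    positivity
  have hnd : (n : ℤ) * ((q - 1) * q ^ 2) = (q + 1 + s) * (2 * d) := by
    apply mul_left_cancel₀ hne
    linear_combination 2 * hsum' - n * hA - 2 * d * hprod
  have hcop : IsCoprime ((q : ℤ) + 1 + s) (((q : ℤ) - 1) * (q : ℤ) ^ 2) := by
    have hc : IsCoprime ((q : ℤ) ^ 2 + 1) (((q : ℤ) - 1) * (q : ℤ) ^ 2) := by
      refine IsCoprime.mul_right ?_ (IsCoprime.pow_right ?_)
      -- Modulo q - 1 the number q² + 1 is 2, so coprimality rests on q being even.
      · obtain ⟨k, hk⟩ := hq2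
        have hk' : (q : ℤ) = k + k := by exact_mod_cast hk
        exact ⟨k, -(k * (q + 1) + 1), by rw [hk']; ring⟩
      · exact ⟨1, -q, by ring⟩
    rw [← hprod] at hc
    exact hc.of_mul_left_right
  obtain ⟨m, hm⟩ : ((q : ℤ) + 1 + s) ∣ n := hcop.dvd_of_dvd_mul_right ⟨_, hnd⟩
  have hmd : m * ((q - 1) * q ^ 2) = 2 * (d : ℤ) := by
    apply mul_left_cancel₀ hpos.ne'
    rw [← hnd, hm]; ring
  have hιne : Nonempty ι := Fintype.card_pos_iff.1 (by rw [hι]; positivity)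
  obtain ⟨i₀⟩ := hιne
  have hfil : ∀ i, A.filter (R i) ⊆ X.filter (R i) := fun i => Finset.filter_subset_filter _ hAX
  have hcast : (((q - 1) * q ^ 2 : ℕ) : ℤ) = (q - 1) * q ^ 2 := by
    push_cast [Nat.cast_sub (by omega : 1 ≤ q)]; ring
  have hcast2 : (((q - 1) * q : ℕ) : ℤ) = (q - 1) * q := by
    push_cast [Nat.cast_sub (by omega : 1 ≤ q)]; ring
  have hdle : (d : ℤ) ≤ (q - 1) * q ^ 2 := by
    have := Finset.card_le_card (hfil i₀)
    rw [hd, h1] at this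
    rw [← hcast]
    exact_mod_cast this
  have hm0 : 0 ≤ m := by
    by_contra h
    have : m * ((q - 1) * q ^ 2) < 0 := mul_neg_of_neg_of_pos (by omega) hK
    omega
  -- From m(q-1)q² = 2d and d ≤ (q-1)q².
  have hm2 : m ≤ 2 := by
    by_contra h
    have : 3 * (((q : ℤ) - 1) * q ^ 2) ≤ m * ((q - 1) * q ^ 2) :=
      mul_le_mul_of_nonneg_right (by omega) hK.le
    omega
  have hvar := sum_sq_incidenceDegree_sub h1 h2
  rw [hι, hX', hcast, hcast2] at hvar
  push_cast at hvar
  -- a class of degree zero is too small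
  have hzero : ∀ (C : Finset α) (s' : ℤ), s' ^ 2 = 2 * q → C ⊆ X →
      2 * (C.card : ℤ) = (q - 1) * q ^ 2 * (q + 1 - s') →
      (∀ x ∈ C, incidenceDegree R x = 0) → False := by
    intro C s' hs' hCX hC h0
    have hle : ∑ x ∈ C, ((incidenceDegree R x : ℤ) - (q + 1)) ^ 2 ≤
        ∑ x ∈ X, ((incidenceDegree R x : ℤ) - (q + 1)) ^ 2 :=
      Finset.sum_le_sum_of_subset_of_nonneg hCX fun _ _ _ => sq_nonneg _
    have hCsum : ∑ x ∈ C, ((incidenceDegree R x : ℤ) - (q + 1)) ^ 2 =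
        (C.card : ℤ) * ((q : ℤ) + 1) ^ 2 := by
      rw [Finset.sum_congr rfl (g := fun _ => ((q : ℤ) + 1) ^ 2), Finset.sum_const, nsmul_eq_mul]
      intro x hx
      rw [h0 x hx]; push_cast; ring
    rw [hCsum, hvar] at hle
    -- The second moment about q + 1 over all of X is 2q|X|. A class C of degree zero alone would
    -- contribute (q+1)²|C|, that is (q+1)(q+1-s')|X|/2, which is larger.
    have h4 := four_mul_lt_of_sq_eq hq' hs'
    have h5 : ((q : ℤ) - 1) * q ^ 2 * (q + 1) * ((q + 1 - s') * (q + 1)) ≤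
        ((q : ℤ) - 1) * q ^ 2 * (q + 1) * (4 * q) := by
      have h6 : 2 * ((C.card : ℤ) * (q + 1) ^ 2) =
          ((q : ℤ) - 1) * q ^ 2 * (q + 1) * ((q + 1 - s') * (q + 1)) := by
        linear_combination (q + 1) ^ 2 * hC
      linear_combination 2 * hle - h6
    have h7 : (0 : ℤ) < ((q : ℤ) - 1) * q ^ 2 * (q + 1) := by positivity
    exact absurd (le_of_mul_le_mul_left h5 h7) (not_le.2 h4)
  have hcomp : 2 * ((X \ A).card : ℤ) = (q - 1) * q ^ 2 * (q + 1 + s) := by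
    rw [Finset.cast_card_sdiff hAX, hX']
    linear_combination -hA
  have hm1 : m = 1 := by
    have h3 : m = 0 ∨ m = 1 ∨ m = 2 := by omega
    rcases h3 with h3 | h3 | h3
    · exfalso
      refine hzero A s hs hAX hA fun x hx => ?_
      have : (n : ℤ) = 0 := by rw [hm, h3, mul_zero]
      rw [hn x hx]
      exact_mod_cast this
    · exact h3
    -- For m = 2 every x in X incident with some block already lies in A, so the complement of A has
    -- degree zero; its size is that of A with s replaced by -s.
    · exfalso
      refine hzero (X \ A) (-s) (by rw [neg_sq, hs]) Finset.sdiff_subset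
        (by rw [hcomp]; ring) fun x hx => ?_
      rw [Finset.mem_sdiff] at hx
      rw [incidenceDegree, Finset.card_eq_zero, Finset.filter_eq_empty_iff]
      intro i _ hi
      have hd' : d = (q - 1) * q ^ 2 := by
        have : (d : ℤ) = (q - 1) * q ^ 2 := by rw [h3] at hmd; omega
        rw [← hcast] at this
        exact_mod_cast this
      have : A.filter (R i) = X.filter (R i) :=
        Finset.eq_of_subset_of_card_le (hfil i) (by rw [hd, h1, hd'])
      have h5 : x ∈ A.filter (R i) := by
        rw [this]; exact Finset.mem_filter.2 ⟨hx.1, hi⟩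
      exact hx.2 (Finset.mem_filter.1 h5).1
  have hnA : ∀ x ∈ A, (incidenceDegree R x : ℤ) = q + 1 + s := fun x hx => by
    rw [hn x hx, hm, hm1, mul_one]
  refine ⟨hnA, ?_⟩
  have hsumA : ∑ x ∈ A, ((incidenceDegree R x : ℤ) - (q + 1 - s)) ^ 2 = A.card * (4 * s ^ 2) := by
    rw [Finset.sum_congr rfl (g := fun _ => 4 * s ^ 2), Finset.sum_const, nsmul_eq_mul]
    intro x hx
    rw [hnA x hx]; ring
  -- About q + 1 - s the points of A contribute 4s² each, and this exhausts the whole second moment.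
  have hsum0 : ∑ x ∈ X \ A, ((incidenceDegree R x : ℤ) - (q + 1 - s)) ^ 2 = 0 := by
    have h3 := Finset.sum_sdiff (f := fun x => ((incidenceDegree R x : ℤ) - (q + 1 - s)) ^ 2) hAX
    rw [hvar, hsumA] at h3
    have h4 : 2 * ∑ x ∈ X \ A, ((incidenceDegree R x : ℤ) - (q + 1 - s)) ^ 2 = 0 := by
      linear_combination 2 * h3 - 4 * s ^ 2 * hA +
        2 * ((q : ℤ) - 1) * q ^ 2 * (q + 1) * hs - 4 * ((q : ℤ) - 1) * q ^ 2 * (q + 1 - s) * hs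
    omega
  intro x hx hxA
  have h3 := (Finset.sum_eq_zero_iff_of_nonneg fun x _ => sq_nonneg _).1 hsum0 x
    (Finset.mem_sdiff.2 ⟨hx, hxA⟩)
  have h4 := pow_eq_zero_iff (two_ne_zero) |>.1 h3
  omega

end Incidence

/-! ### Ovoids of Q(4,q) and lines of an elliptic quadric -/

section Ovoids

variable {F V ι : Type*} [Field F] [AddCommGroup V] [Module F V] [Fintype ι]

theorem card_filter_univ_eq_ncard {α : Type*} [Fintype α] (p : α → Prop) [DecidablePred p] :
    (Finset.univ.filter p).card = {x | p x}.ncard := by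
  rw [← Set.ncard_coe_finset, Finset.coe_filter]
  simp

/-- The family `τ` of vectors spans a set of pairwise non-collinear points of the parabolic
quadric of `N^⊥` that has the size `q² + 1` of an ovoid. -/
structure IsOvoidFamily (Q : QuadraticForm F V) (N : V) (τ : ι → V) : Prop where
  singular : ∀ i, Q (τ i) = 0
  mem_perp : ∀ i, Q.polarBilin N (τ i) = 0
  polar_ne_zero : ∀ i j, i ≠ j → Q.polarBilin (τ i) (τ j) ≠ 0
  card_eq : Fintype.card ι = Nat.card F ^ 2 + 1

namespace IsOvoidFamily

variable {Q : QuadraticForm F V} {N : V} {τ : ι → V}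

theorem exists_ne [Finite F] (hτ : IsOvoidFamily Q N τ) (i : ι) : ∃ j, j ≠ i := by
  have : 1 < Fintype.card ι := by
    rw [hτ.card_eq]
    have : 0 < Nat.card F := Nat.card_pos
    have : 0 < Nat.card F ^ 2 := by positivity
    omega
  exact Fintype.exists_ne_of_one_lt_card this i

theorem ne_zero [Finite F] (hτ : IsOvoidFamily Q N τ) (i : ι) : τ i ≠ 0 := by
  intro h
  obtain ⟨j, hj⟩ := hτ.exists_ne i
  exact hτ.polar_ne_zero j i hj (by rw [h, map_zero])

theorem polar_eq_zero_iff [CharP F 2] (hτ : IsOvoidFamily Q N τ) {i j : ι} :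
    Q.polarBilin (τ i) (τ j) = 0 ↔ i = j := by
  refine ⟨fun h => ?_, fun h => by rw [h, polarBilin_self]⟩
  by_contra hij
  exact hτ.polar_ne_zero i j hij h

open Classical in
theorem incidenceDegree_smul [CharP F 2] (hτ : IsOvoidFamily Q N τ) (i : ι) {a : F} (ha : a ≠ 0) :
    incidenceDegree (fun j x => Q.polarBilin x (τ j) = 0) (a • τ i) = 1 := by
  rw [incidenceDegree, Finset.card_eq_one]
  refine ⟨i, ?_⟩
  ext j
  simp only [Finset.mem_filter, Finset.mem_univ, true_and, Finset.mem_singleton]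
  rw [map_smul, LinearMap.smul_apply, smul_eq_mul, mul_eq_zero, or_iff_right ha,
    hτ.polar_eq_zero_iff, eq_comm]

/-- Without the condition Q x = 0 these are orthogonal complements of dimension 5, 4 and 3. They are
stable under translation by multiples of N, so exactly one vector in q is singular. The zero vector
is included in all three counts. -/
theorem ncard_perp [Finite F] [CharP F 2] (hV : finrank F V = 6)
    (hB : Q.polarBilin.Nondegenerate) (hN : Q N ≠ 0) (hτ : IsOvoidFamily Q N τ) :
    {x | Q.polarBilin N x = 0 ∧ Q x = 0}.ncard = Nat.card F ^ 4 ∧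
      (∀ i, {x | (Q.polarBilin N x = 0 ∧ Q x = 0) ∧ Q.polarBilin x (τ i) = 0}.ncard =
        Nat.card F ^ 3) ∧
      ∀ i j, i ≠ j → {x | (Q.polarBilin N x = 0 ∧ Q x = 0) ∧ Q.polarBilin x (τ i) = 0 ∧
        Q.polarBilin x (τ j) = 0}.ncard = Nat.card F ^ 2 := by
  have hfin : Module.Finite F V := Module.finite_of_finrank_pos (by rw [hV]; norm_num)
  have hq1 : 0 < Nat.card F := Nat.card_pos
  have hNN : Q.polarBilin N N = 0 := polarBilin_self Q N
  have hN0 : N ≠ 0 := fun h => hN (by rw [h, Q.map_zero])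
  have hτN : ∀ i, Q.polarBilin (τ i) N = 0 := fun i => by rw [polarBilin_comm, hτ.mem_perp]
  refine ⟨?_, fun i => ?_, fun i j hij => ?_⟩
  · have h1 := ncard_orthogonal hB (v := ![N]) (by simpa using hN0)
    have h2 := ncard_singular_mul hN
      (S := {x | ∀ i, Q.polarBilin ((![N] : Fin 1 → V) i) x = 0})
      (fun x hx => hx 0) (fun x hx a => by
        simp only [Set.mem_ofPred_eq, Fin.forall_fin_one, Matrix.cons_val_zero] at hx ⊢
        rw [map_add, map_smul, hx, hNN, smul_zero, add_zero])
    rw [h1, hV] at h2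
    apply Nat.eq_of_mul_eq_mul_right hq1
    rw [← pow_succ, ← h2]
    congr 2
    ext x
    simp
  · have h1 := ncard_orthogonal hB (v := ![N, τ i]) (by
      rw [LinearIndependent.pair_iff' hN0]
      intro a ha
      have ha' := congrArg Q ha
      rw [map_smul_form, hτ.singular, mul_eq_zero, or_iff_left hN, sq_eq_zero_iff] at ha'
      rw [ha', zero_smul] at ha
      exact hτ.ne_zero i ha.symm)
    have h2 := ncard_singular_mul hN
      (S := {x | ∀ k, Q.polarBilin ((![N, τ i] : Fin 2 → V) k) x = 0})
      (fun x hx => hx 0) (fun x hx a => by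
        simp only [Set.mem_ofPred_eq, Fin.forall_fin_two, Matrix.cons_val_zero,
          Matrix.cons_val_one, Matrix.cons_val_fin_one] at hx ⊢
        constructor
        · rw [map_add, map_smul, hx.1, hNN, smul_zero, add_zero]
        · rw [map_add, map_smul, hx.2, hτN, smul_zero, add_zero])
    rw [h1, hV] at h2
    apply Nat.eq_of_mul_eq_mul_right hq1
    rw [← pow_succ, ← h2]
    congr 2
    ext x
    simp only [Set.mem_ofPred_eq, Fin.forall_fin_two, Matrix.cons_val_zero,
      Matrix.cons_val_one, Matrix.cons_val_fin_one]
    rw [polarBilin_comm Q x]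
    tauto
  · have h1 := ncard_orthogonal hB (v := ![N, τ i, τ j]) (by
      refine linearIndependent_triple fun a b c h => ?_
      have hb := congrArg (Q.polarBilin (τ j)) h
      have hc := congrArg (Q.polarBilin (τ i)) h
      simp only [map_add, map_smul, map_zero, polarBilin_self, hτN, smul_eq_mul, mul_zero,
        add_zero, zero_add, mul_eq_zero, hτ.polar_ne_zero i j hij, hτ.polar_ne_zero j i hij.symm,
        or_false] at hb hc
      subst hb hc
      simpa [hN0] using h)
    have h2 := ncard_singular_mul hN
      (S := {x | ∀ k, Q.polarBilin ((![N, τ i, τ j] : Fin 3 → V) k) x = 0})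
      (fun x hx => hx 0) (fun x hx a k => by
        have hx0 := hx 0
        have hx1 := hx 1
        have hx2 := hx 2
        fin_cases k
        · change Q.polarBilin N x = 0 at hx0
          change Q.polarBilin N (x + a • N) = 0
          rw [map_add, map_smul, hx0, hNN, smul_zero, add_zero]
        · change Q.polarBilin (τ i) x = 0 at hx1
          change Q.polarBilin (τ i) (x + a • N) = 0
          rw [map_add, map_smul, hx1, hτN, smul_zero, add_zero]
        · change Q.polarBilin (τ j) x = 0 at hx2
          change Q.polarBilin (τ j) (x + a • N) = 0
          rw [map_add, map_smul, hx2, hτN, smul_zero, add_zero])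
    rw [h1, hV] at h2
    apply Nat.eq_of_mul_eq_mul_right hq1
    rw [← pow_succ, ← h2]
    congr 2
    ext x
    constructor
    · rintro ⟨⟨h3, h4⟩, h5, h6⟩
      refine ⟨fun k => ?_, h4⟩
      rw [polarBilin_comm] at h5 h6
      fin_cases k <;> assumption
    · rintro ⟨h3, h4⟩
      exact ⟨⟨h3 0, h4⟩, (polarBilin_comm _ _ _).trans (h3 1),
        (polarBilin_comm _ _ _).trans (h3 2)⟩

open Classical in
/-- A point of the parabolic quadric off the ovoid is collinear with `q + 1` points of the
ovoid. -/
theorem incidenceDegree_eq [Finite F] [CharP F 2] (hV : finrank F V = 6)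
    (hB : Q.polarBilin.Nondegenerate) (hN : Q N ≠ 0) (hτ : IsOvoidFamily Q N τ) {P : V}
    (hP0 : P ≠ 0) (hP : Q P = 0) (hNP : Q.polarBilin N P = 0)
    (hPτ : ∀ i, P ∉ Submodule.span F {τ i}) :
    incidenceDegree (fun j x => Q.polarBilin x (τ j) = 0) P = Nat.card F + 1 := by
  have hfin : Module.Finite F V := Module.finite_of_finrank_pos (by rw [hV]; norm_num)
  have hfinV : Finite V := Module.finite_of_finite F
  have := Fintype.ofFinite V
  have := Fintype.ofFinite F
  set q := Nat.card F with hq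
  set R : ι → V → Prop := fun j x => Q.polarBilin x (τ j) = 0 with hR
  obtain ⟨h0, h1, h2⟩ := hτ.ncard_perp hV hB hN
  let S : Finset V := Finset.univ.filter fun x => Q.polarBilin N x = 0 ∧ Q x = 0
  have hS0 : S.card = q ^ 4 := by rw [card_filter_univ_eq_ncard, h0]
  have hS1 : ∀ i, (S.filter (R i)).card = q ^ 3 := fun i => by
    rw [Finset.filter_filter, card_filter_univ_eq_ncard, h1]
  have hS2 : ∀ i j, i ≠ j → (S.filter fun x => R i x ∧ R j x).card = q ^ 2 := fun i j hij => by
    rw [Finset.filter_filter, card_filter_univ_eq_ncard, h2 i j hij]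
  have hvar := sum_sq_incidenceDegree_sub hS1 hS2 (q + 1)
  rw [hτ.card_eq, hS0] at hvar
  have hinj : Set.InjOn (fun z : ι × Fˣ => (z.2 : F) • τ z.1)
      (Finset.univ : Finset (ι × Fˣ)) := by
    rintro ⟨i, a⟩ - ⟨j, b⟩ - h
    have h' : (a : F) • τ i = (b : F) • τ j := h
    have hij : i = j := by
      have h3 := congrArg (fun x => Q.polarBilin x (τ j)) h'
      simp only [map_smul, LinearMap.smul_apply, polarBilin_self, smul_eq_mul, mul_zero,
        mul_eq_zero, a.ne_zero, false_or] at h3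
      exact hτ.polar_eq_zero_iff.1 h3
    subst hij
    rw [Units.ext (smul_left_injective F (hτ.ne_zero i) h')]
  let T : Finset V := Finset.univ.image fun z : ι × Fˣ => (z.2 : F) • τ z.1
  have h0T : (0 : V) ∉ T := by
    intro h
    obtain ⟨z, -, hz⟩ := Finset.mem_image.1 h
    exact smul_ne_zero z.2.ne_zero (hτ.ne_zero z.1) hz
  have hTS : insert 0 T ⊆ S := by
    intro x hx
    rcases Finset.mem_insert.1 hx with rfl | hx
    · simp [S]
    · obtain ⟨z, -, rfl⟩ := Finset.mem_image.1 hx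
      simp only [S, Finset.mem_filter, Finset.mem_univ, map_smul, map_smul_form,
        hτ.singular, hτ.mem_perp, smul_zero, mul_zero, and_self]
  have hsumT : ∑ x ∈ T, ((incidenceDegree R x : ℤ) - (q + 1)) ^ 2 =
      ((q : ℤ) ^ 2 + 1) * ((q : ℤ) - 1) * (q : ℤ) ^ 2 := by
    rw [Finset.sum_image hinj, Finset.sum_congr rfl (g := fun _ => (q : ℤ) ^ 2), Finset.sum_const,
      Finset.card_univ, Fintype.card_prod, hτ.card_eq, ← Nat.card_eq_fintype_card (α := Fˣ),
      Nat.card_units, nsmul_eq_mul]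
    · have : 1 ≤ Nat.card F := Nat.card_pos
      push_cast [Nat.cast_sub this]
      ring
    · intro z _
      rw [hτ.incidenceDegree_smul z.1 z.2.ne_zero]
      push_cast
      ring
  have hdeg0 : incidenceDegree R 0 = q ^ 2 + 1 := by
    rw [← hτ.card_eq, incidenceDegree, Finset.filter_true_of_mem, Finset.card_univ]
    intro i _
    simp [hR]
  -- The zero vector contributes (q² - q)² and each of the (q² + 1)(q - 1) nonzero multiples of
  -- ovoid vectors contributes q². Together they exhaust the second moment about q + 1, so every
  -- other vector has degree exactly q + 1.
  have hrest : ∑ x ∈ S \ insert 0 T, ((incidenceDegree R x : ℤ) - (q + 1)) ^ 2 = 0 := by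
    have h3 := Finset.sum_sdiff (f := fun x => ((incidenceDegree R x : ℤ) - (q + 1)) ^ 2) hTS
    rw [hvar, Finset.sum_insert h0T, hsumT, hdeg0] at h3
    push_cast at h3
    linear_combination h3
  have hPS : P ∈ S \ insert 0 T := by
    refine Finset.mem_sdiff.2 ⟨by simpa [S] using ⟨hNP, hP⟩, fun h => ?_⟩
    rcases Finset.mem_insert.1 h with h | h
    · exact hP0 h
    · obtain ⟨z, -, hz⟩ := Finset.mem_image.1 h
      exact hPτ z.1 (Submodule.mem_span_singleton.2 ⟨_, hz⟩)
  have h3 := (Finset.sum_eq_zero_iff_of_nonneg fun x _ => sq_nonneg _).1 hrest P hPS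
  have h4 := pow_eq_zero_iff (two_ne_zero) |>.1 h3
  omega

open Classical in
/-- The sum of the degrees of the affine points of a line of an elliptic quadric that meets `N^⊥`
in the point spanned by `P`. -/
theorem sum_incidenceDegree_line [Fintype F] [CharP F 2] (hV : finrank F V = 6)
    (hQ : IsElliptic Q) (hN : Q N ≠ 0) (hτ : IsOvoidFamily Q N τ) {x P : V}
    (hx : Q x = 0) (hNx : Q.polarBilin N x = 1) (hP0 : P ≠ 0) (hP : Q P = 0)
    (hNP : Q.polarBilin N P = 0) (hxP : Q.polarBilin x P = 0) :
    ((∃ i, P ∈ Submodule.span F {τ i}) →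
      ∑ a : F, incidenceDegree (fun j x => Q.polarBilin x (τ j) = 0) (x + a • P) =
        Nat.card F ^ 2 + Nat.card F) ∧
    ((∀ i, P ∉ Submodule.span F {τ i}) →
      ∑ a : F, incidenceDegree (fun j x => Q.polarBilin x (τ j) = 0) (x + a • P) + Nat.card F =
        Nat.card F ^ 2) := by
  have hsum : ∑ a : F, incidenceDegree (fun j x => Q.polarBilin x (τ j) = 0) (x + a • P) =
      ∑ i, (Finset.univ.filter fun a : F => Q.polarBilin (x + a • P) (τ i) = 0).card :=
    sum_incidenceDegree (fun j a => Q.polarBilin (x + a • P) (τ j) = 0) Finset.univ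
  -- An ovoid vector not orthogonal to P is orthogonal to exactly one x + aP, the zero of a
  -- nonconstant affine function of a.
  have hgen : ∀ i, Q.polarBilin P (τ i) ≠ 0 →
      (Finset.univ.filter fun a : F => Q.polarBilin (x + a • P) (τ i) = 0).card = 1 := by
    intro i hi
    rw [Finset.card_eq_one]
    refine ⟨-(Q.polarBilin x (τ i)) / Q.polarBilin P (τ i), ?_⟩
    ext a
    simp only [Finset.mem_filter, Finset.mem_univ, true_and, Finset.mem_singleton]
    rw [map_add, map_smul, LinearMap.add_apply, LinearMap.smul_apply, smul_eq_mul, eq_div_iff hi,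
      eq_neg_iff_add_eq_zero, add_comm]
  have hPx : Q.polarBilin P x = 0 := by rw [polarBilin_comm, hxP]
  rw [hsum]
  constructor
  · rintro ⟨i, hi⟩
    obtain ⟨c, rfl⟩ := Submodule.mem_span_singleton.1 hi
    have hc : c ≠ 0 := fun h => hP0 (by rw [h, zero_smul])
    have hxi : Q.polarBilin x (τ i) = 0 := by
      rw [map_smul, smul_eq_mul, mul_eq_zero, or_iff_right hc] at hxP
      exact hxP
    -- The ovoid vector on P is orthogonal to all q affine points; each of the other q² is not
    -- orthogonal to P and counts once.
    rw [← Finset.add_sum_erase _ _ (Finset.mem_univ i), Finset.sum_congr rfl (g := fun _ => 1),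
      Finset.sum_const, Finset.card_erase_of_mem (Finset.mem_univ i), Finset.card_univ,
      hτ.card_eq, Finset.filter_true_of_mem, Finset.card_univ, ← Nat.card_eq_fintype_card]
    · simp [add_comm]
    · intro a _
      rw [map_add, map_smul, map_smul, LinearMap.add_apply, LinearMap.smul_apply,
        LinearMap.smul_apply, hxi, polarBilin_self, smul_zero, smul_zero, add_zero]
    · intro j hj
      refine hgen j ?_
      rw [map_smul, LinearMap.smul_apply, smul_eq_mul]
      exact mul_ne_zero hc (hτ.polar_ne_zero i j (Finset.ne_of_mem_erase hj).symm)
  · intro hPτ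
    have hdeg := hτ.incidenceDegree_eq hV hQ.1 hN hP0 hP hNP hPτ
    rw [incidenceDegree] at hdeg
    -- An ovoid vector orthogonal to P and to an affine point of the line would span with them a
    -- plane of the elliptic quadric. So the q + 1 ovoid points orthogonal to P count zero.
    have hzero : ∀ i, Q.polarBilin P (τ i) = 0 →
        (Finset.univ.filter fun a : F => Q.polarBilin (x + a • P) (τ i) = 0).card = 0 := by
      intro i hi
      rw [Finset.card_eq_zero, Finset.filter_eq_empty_iff]
      intro a _ ha
      rw [map_add, map_smul, LinearMap.add_apply, LinearMap.smul_apply, hi, smul_zero,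
        add_zero] at ha
      refine hQ.not_totally_singular (x := x) (y := P) (z := τ i) ?_ hx hP (hτ.singular i) hxP ha hi
      refine linearIndependent_triple fun a b c h => ?_
      have h1 := congrArg (Q.polarBilin N) h
      simp only [map_add, map_smul, map_zero, hNx, hNP, hτ.mem_perp, smul_eq_mul, mul_zero,
        mul_one, add_zero] at h1
      subst h1
      rw [zero_smul, zero_add] at h
      have hb : b = 0 := by
        by_contra hb
        refine hPτ i (Submodule.mem_span_singleton.2 ⟨-(b⁻¹ * c), ?_⟩)
        rw [neg_smul, mul_smul, eq_comm, eq_neg_iff_add_eq_zero]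
        have := congrArg (b⁻¹ • ·) h
        simpa [smul_smul, hb] using this
      subst hb
      rw [zero_smul, zero_add, smul_eq_zero, or_iff_left (hτ.ne_zero i)] at h
      exact ⟨rfl, rfl, h⟩
    have hsplit : ∀ i, (Finset.univ.filter fun a : F =>
        Q.polarBilin (x + a • P) (τ i) = 0).card =
        if Q.polarBilin P (τ i) = 0 then 0 else 1 := by
      intro i
      split_ifs with h
      · exact hzero i h
      · exact hgen i h
    rw [Finset.sum_congr rfl fun i _ => hsplit i]
    have h3 := Finset.card_filter_add_card_filter_not (s := (Finset.univ : Finset ι))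
      (fun i => Q.polarBilin P (τ i) = 0)
    rw [hdeg, Finset.card_univ, hτ.card_eq] at h3
    have h4 : ∑ i, (if Q.polarBilin P (τ i) = 0 then 0 else 1) =
        (Finset.univ.filter fun i => ¬ Q.polarBilin P (τ i) = 0).card := by
      rw [Finset.card_filter]
      refine Finset.sum_congr rfl fun i _ => ?_
      split_ifs <;> simp_all
    rw [h4]
    omega

end IsOvoidFamily

end Ovoids

/-! ### Orbits on an elliptic quadric and their intersections with lines -/

section OrbitsOnLines

variable {F V : Type*} [Field F] [AddCommGroup V] [Module F V]

/-- Normalising f to 1 selects one vector on each point off the hyperplane, so that sets of points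
can be counted as sets of vectors. -/
theorem ncard_eq_ncard_affine {f : Dual F V} {S : Set (ℙ F V)}
    (hS : Disjoint S (pointsOf (LinearMap.ker f))) :
    {x | f x = 1 ∧ ∃ hx : x ≠ 0, Projectivization.mk F x hx ∈ S}.ncard = S.ncard := by
  refine Set.ncard_congr (fun x h => Projectivization.mk F x h.2.choose) ?_ ?_ ?_
  · intro x h
    exact h.2.choose_spec
  · intro x y hx hy h
    exact mk_inj_of_apply_eq_one hx.1 hy.1 h
  · intro p hp
    obtain ⟨x, hx, hfx, rfl⟩ := exists_mk_of_notMem_ker (Set.disjoint_left.1 hS hp)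
    exact ⟨x, ⟨hfx, hx, hp⟩, rfl⟩

theorem exists_rep_smul (g : V ≃ₗ[F] V) (p : ℙ F V) :
    ∃ c : F, c ≠ 0 ∧ (g • p).rep = c • g p.rep := by
  obtain ⟨a, ha⟩ := Projectivization.exists_smul_eq_mk_rep F (g p.rep)
    (by simpa using p.rep_nonzero)
  refine ⟨a, a.ne_zero, ?_⟩
  conv_lhs => rw [← p.mk_rep]
  exact ha.symm

/-- Bijectivity is not assumed: for isometric endomorphisms injectivity is deduced from this
identity. -/
theorem polarBilin_isometry {Q : QuadraticForm F V} {g : V → V} (hadd : ∀ x y, g (x + y) = g x + g y)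
    (hg : ∀ x, Q (g x) = Q x) (x y : V) : Q.polarBilin (g x) (g y) = Q.polarBilin x y := by
  have h1 := map_add_polarBilin Q (g x) (g y)
  rw [← hadd, hg, hg, hg, map_add_polarBilin] at h1
  exact (add_left_cancel h1).symm

/-- The intersection numbers with lines of an orbit, on an elliptic quadric, of a group acting
transitively on an ovoid of the parabolic quadric in `N^⊥`. -/
theorem ncard_line_inter_orbit [Finite F] [CharP F 2] (hV : finrank F V = 6)
    {Q : QuadraticForm F V} (hQ : IsElliptic Q) {N : V} (hN : Q N ≠ 0)
    (hq : 8 ≤ Nat.card F) (hq2 : Even (Nat.card F)) {s : ℤ} (hs : s ^ 2 = 2 * Nat.card F)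
    {T : Set (ℙ F V)} (hT : T ⊆ baseLocus Q N)
    (hTT : ∀ t ∈ T, ∀ t' ∈ T, t ≠ t' → Q.polarBilin t.rep t'.rep ≠ 0)
    (hTcard : T.ncard = Nat.card F ^ 2 + 1)
    {G : Subgroup (V ≃ₗ[F] V)} (hGQ : ∀ g ∈ G, ∀ x, Q (g x) = Q x) (hGN : ∀ g ∈ G, g N = N)
    (hGT : ∀ g ∈ G, ∀ t ∈ T, g • t ∈ T) (htrans : ∀ t ∈ T, ∀ t' ∈ T, ∃ g ∈ G, g • t = t')
    {A : Set (ℙ F V)} (hA : IsOrbitOn G (quadric Q \ baseLocus Q N) A)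
    (hAcard : 2 * (A.ncard : ℤ) =
      ((Nat.card F : ℤ) - 1) * (Nat.card F : ℤ) ^ 2 * (Nat.card F + 1 - s))
    {l : Submodule F V} (hl : IsPolarLine Q.polarBilin l) (hlQ : pointsOf l ⊆ quadric Q)
    {P : ℙ F V} (hlP : pointsOf l ∩ baseLocus Q N = {P}) :
    (P ∈ T → 2 * ((pointsOf l ∩ A).ncard : ℤ) = Nat.card F) ∧
      (P ∉ T → 2 * ((pointsOf l ∩ A).ncard : ℤ) = Nat.card F - s) := by
  classical
  have hfin : Module.Finite F V := Module.finite_of_finrank_pos (by rw [hV]; norm_num)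
  have hfinV : Finite V := Module.finite_of_finite F
  have := Fintype.ofFinite V
  have := Fintype.ofFinite F
  have hTfin : T.Finite := Set.finite_of_ncard_ne_zero (by rw [hTcard]; omega)
  have := hTfin.fintype
  set q := Nat.card F with hqdef
  set f := Q.polarBilin N with hf
  have hbase : ∀ p : ℙ F V, p ∈ baseLocus Q N ↔ Q p.rep = 0 ∧ f p.rep = 0 := fun p => by
    rw [baseLocus, Set.mem_inter_iff, mem_quadric_iff_rep, mem_pointsOf_iff_rep, LinearMap.mem_ker]
  let τ : T → V := fun t => t.1.rep
  have hτ : IsOvoidFamily Q N τ :=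
    { singular := fun t => ((hbase t.1).1 (hT t.2)).1
      mem_perp := fun t => ((hbase t.1).1 (hT t.2)).2
      polar_ne_zero := fun t t' h => hTT t.1 t.2 t'.1 t'.2 fun h' => h (Subtype.ext h')
      card_eq := by rw [← hTcard, ← Nat.card_coe_set_eq, Nat.card_eq_fintype_card] }
  have hGB : ∀ g ∈ G, ∀ x y, Q.polarBilin (g x) (g y) = Q.polarBilin x y := fun g hg =>
    polarBilin_isometry (map_add g) (hGQ g hg)
  have hGf : ∀ g ∈ G, ∀ x, f (g x) = f x := fun g hg x => by
    have := hGB g hg N x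
    rwa [hGN g hg] at this
  have hGτ : ∀ g ∈ G, ∀ (x : V) (t : ℙ F V),
      Q.polarBilin (g x) (g • t).rep = 0 ↔ Q.polarBilin x t.rep = 0 := by
    intro g hg x t
    obtain ⟨c, hc, h⟩ := exists_rep_smul g t
    rw [h, map_smul, hGB g hg, smul_eq_mul, mul_eq_zero, or_iff_right hc]
  -- the affine representatives of the points of `A`
  obtain ⟨p₀, ⟨hp₀Q, hp₀b⟩, rfl⟩ := hA
  set A := MulAction.orbit G p₀ with hAdef
  have hp₀f : p₀ ∉ pointsOf (LinearMap.ker f) := fun h => hp₀b ⟨hp₀Q, h⟩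
  obtain ⟨x₀, hx₀, hfx₀, rfl⟩ := exists_mk_of_notMem_ker hp₀f
  rw [mk_mem_quadric] at hp₀Q
  -- The group preserves f, so the normalised vectors of the points of A are precisely the orbit of
  -- the vector x₀, with no scalars left over.
  have hAmem : ∀ x, (f x = 1 ∧ ∃ hx : x ≠ 0, Projectivization.mk F x hx ∈ A) ↔
      ∃ g ∈ G, g x₀ = x := by
    intro x
    constructor
    · rintro ⟨hfx, hx, ⟨g, hg⟩, h⟩
      refine ⟨g, hg, ?_⟩
      have h' : Projectivization.mk F (g x₀) (by simpa using hx₀) =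
          Projectivization.mk F x hx := h
      exact mk_inj_of_apply_eq_one (by rw [hGf g hg, hfx₀]) hfx h'
    · rintro ⟨g, hg, rfl⟩
      exact ⟨by rw [hGf g hg, hfx₀], by simpa using hx₀, ⟨⟨g, hg⟩, rfl⟩⟩
  have hAdisj : Disjoint A (pointsOf (LinearMap.ker f)) := by
    rw [Set.disjoint_left]
    rintro _ ⟨⟨g, hg⟩, rfl⟩ h
    have h' : g x₀ ∈ LinearMap.ker f := (mk_mem_pointsOf (by simpa using hx₀)).1 h
    rw [LinearMap.mem_ker, hGf g hg, hfx₀] at h'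
    exact one_ne_zero h'
  let X : Finset V := Finset.univ.filter fun x => f x = 1 ∧ Q x = 0
  let A' : Finset V := Finset.univ.filter fun x => ∃ g ∈ G, g x₀ = x
  let R : T → V → Prop := fun t x => Q.polarBilin x (τ t) = 0
  have hA'A : A'.card = A.ncard := by
    rw [card_filter_univ_eq_ncard, ← ncard_eq_ncard_affine hAdisj]
    simp only [hAmem]
  have hne : ∃ t t' : T, t ≠ t' := by
    have : 0 < Fintype.card T := by rw [hτ.card_eq]; positivity
    obtain ⟨t⟩ := Fintype.card_pos_iff.1 this
    obtain ⟨t', h⟩ := hτ.exists_ne t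
    exact ⟨t, t', h.symm⟩
  have hcounts : ∀ t t' : T, t ≠ t' → _ := fun t t' h =>
    hQ.ncard_affine hV hN (hτ.singular t) (hτ.singular t') (hτ.mem_perp t) (hτ.mem_perp t')
      (hτ.polar_ne_zero t t' h)
  -- The constants n and d are read off at x₀ and at one chosen point of T. Constancy of the degree
  -- uses that A is an orbit; constancy of d uses transitivity on T.
  have hdeg := incidenceDegree_eq_of_tactical (R := R) (X := X) (A := A') (q := q) (s := s)
    (n := incidenceDegree R x₀) (d := (A'.filter (R hne.choose)).card) hq hq2 hs hτ.card_eq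
    (by
      obtain ⟨t, t', h⟩ := hne
      rw [card_filter_univ_eq_ncard, (hcounts t t' h).1])
    (fun t => by
      obtain ⟨t', h⟩ := hτ.exists_ne t
      rw [Finset.filter_filter, card_filter_univ_eq_ncard, (hcounts t t' h.symm).2.1])
    (fun t t' h => by
      rw [Finset.filter_filter, card_filter_univ_eq_ncard, (hcounts t t' h).2.2])
    (by
      intro x hx
      obtain ⟨g, hg, rfl⟩ := (Finset.mem_filter.1 hx).2
      refine Finset.mem_filter.2 ⟨Finset.mem_univ _, ?_, ?_⟩
      · rw [hGf g hg, hfx₀]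
      · rw [hGQ g hg, hp₀Q])
    (by rw [hA'A, hAcard])
    (by
      intro x hx
      obtain ⟨g, hg, rfl⟩ := (Finset.mem_filter.1 hx).2
      symm
      refine Finset.card_bij (fun t _ => ⟨g • t.1, hGT g hg t.1 t.2⟩) ?_ ?_ ?_
      · intro t ht
        simp only [Finset.mem_filter, Finset.mem_univ, true_and] at ht ⊢
        exact (hGτ g hg x₀ t.1).2 ht
      · intro t _ t' _ h
        exact Subtype.ext (MulAction.injective g (congrArg Subtype.val h))
      · intro t ht
        simp only [Finset.mem_filter, Finset.mem_univ, true_and] at ht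
        have h1 : g • g⁻¹ • t.1 = t.1 := smul_inv_smul g t.1
        refine ⟨⟨g⁻¹ • t.1, hGT _ (G.inv_mem hg) _ t.2⟩, ?_, Subtype.ext h1⟩
        simp only [Finset.mem_filter, Finset.mem_univ, true_and]
        refine (hGτ g hg x₀ (g⁻¹ • t.1)).1 ?_
        rw [h1]
        exact ht)
    (by
      intro t
      obtain ⟨g, hg, hgt⟩ := htrans hne.choose.1 hne.choose.2 t.1 t.2
      symm
      refine Finset.card_bij (fun x _ => g x) ?_ ?_ ?_
      · intro x hx
        obtain ⟨hx1, hx2⟩ := Finset.mem_filter.1 hx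
        obtain ⟨g', hg', rfl⟩ := (Finset.mem_filter.1 hx1).2
        refine Finset.mem_filter.2 ⟨Finset.mem_filter.2 ⟨Finset.mem_univ _, g * g',
          G.mul_mem hg hg', rfl⟩, ?_⟩
        have := (hGτ g hg (g' x₀) hne.choose.1).2 hx2
        rwa [hgt] at this
      · intro x _ y _ h
        exact g.injective h
      · intro x hx
        obtain ⟨hx1, hx2⟩ := Finset.mem_filter.1 hx
        obtain ⟨g', hg', rfl⟩ := (Finset.mem_filter.1 hx1).2
        have h1 : g ((g⁻¹ * g') x₀) = g' x₀ := g.apply_symm_apply (g' x₀)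
        refine ⟨(g⁻¹ * g') x₀, Finset.mem_filter.2 ⟨Finset.mem_filter.2 ⟨Finset.mem_univ _,
          g⁻¹ * g', G.mul_mem (G.inv_mem hg) hg', rfl⟩, ?_⟩, h1⟩
        refine (hGτ g hg _ hne.choose.1).1 ?_
        rw [h1, hgt]
        exact hx2)
  -- the affine points of the line
  have hPmem : P ∈ pointsOf l ∩ baseLocus Q N := by rw [hlP]; rfl
  have hPl : P.rep ∈ l := mem_pointsOf_iff_rep.1 hPmem.1
  obtain ⟨hPQ, hPf⟩ := (hbase P).1 hPmem.2
  have hlker : ∀ y ∈ l, f y = 0 → ∃ a : F, a • P.rep = y := by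
    intro y hy hfy
    by_cases hy0 : y = 0
    · exact ⟨0, by rw [hy0, zero_smul]⟩
    have h1 : Projectivization.mk F y hy0 ∈ pointsOf l := (mk_mem_pointsOf hy0).2 hy
    have h2 : Projectivization.mk F y hy0 ∈ pointsOf l ∩ baseLocus Q N :=
      ⟨h1, hlQ h1, (mk_mem_pointsOf hy0).2 hfy⟩
    rw [hlP, Set.mem_singleton_iff] at h2
    rw [← P.mk_rep] at h2
    exact (Projectivization.mk_eq_mk_iff' F _ _ _ _).1 h2
  obtain ⟨x, hxl, hfx⟩ : ∃ x ∈ l, f x = 1 := by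
    by_contra! h
    have h0 : ∀ y ∈ l, f y = 0 := by
      intro y hy
      by_contra h1
      exact h _ (l.smul_mem (f y)⁻¹ hy) (by rw [map_smul, smul_eq_mul, inv_mul_cancel₀ h1])
    have h1 : pointsOf l ⊆ {P} := by
      rw [← hlP]
      refine fun p hp => ⟨hp, hlQ hp, ?_⟩
      exact mem_pointsOf_iff_rep.2 (h0 _ (mem_pointsOf_iff_rep.1 hp))
    have h2 := Set.ncard_le_ncard h1
    rw [ncard_pointsOf_of_finrank_two hl.1, Set.ncard_singleton] at h2
    omega
  have hlQ' := pointsOf_subset_quadric_iff.1 hlQ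
  have hlA : ((pointsOf l ∩ A).ncard : ℤ) =
      (Finset.univ.filter fun a : F => x + a • P.rep ∈ A').card := by
    rw [← ncard_eq_ncard_affine (hAdisj.mono_left Set.inter_subset_right),
      card_filter_univ_eq_ncard]
    congr 1
    symm
    refine Set.ncard_congr (fun a _ => x + a • P.rep) ?_ ?_ ?_
    · intro a ha
      obtain ⟨h1, h2, h3⟩ := (hAmem _).2 (Finset.mem_filter.1 ha).2
      exact ⟨h1, h2, (mk_mem_pointsOf h2).2 (l.add_mem hxl (l.smul_mem a hPl)), h3⟩
    · intro a b _ _ h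
      exact smul_left_injective F P.rep_nonzero (add_left_cancel h)
    · rintro y ⟨hfy, hy0, hyl, hyA⟩
      rw [mk_mem_pointsOf] at hyl
      obtain ⟨a, ha⟩ := hlker (y - x) (l.sub_mem hyl hxl) (by rw [map_sub, hfx, hfy, sub_self])
      have hay : x + a • P.rep = y := by rw [ha, add_sub_cancel]
      refine ⟨a, ?_, hay⟩
      refine Finset.mem_filter.2 ⟨Finset.mem_univ _, ?_⟩
      rw [hay]
      exact (hAmem y).1 ⟨hfy, hy0, hyA⟩
  -- With k points of A on the line, the sum is k(q+1+s) + (q-k)(q+1-s).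
  have hsumdeg : ∑ a : F, (incidenceDegree R (x + a • P.rep) : ℤ) =
      q * (q + 1 - s) + 2 * s * (pointsOf l ∩ A).ncard := by
    have h1 : ∀ a ∈ (Finset.univ : Finset F), (incidenceDegree R (x + a • P.rep) : ℤ) =
        (q + 1 - s) + if x + a • P.rep ∈ A' then 2 * s else 0 := by
      intro a _
      split_ifs with h
      · rw [hdeg.1 _ h]; ring
      · rw [hdeg.2 _ _ h, add_zero]
        refine Finset.mem_filter.2 ⟨Finset.mem_univ _, ?_, ?_⟩
        · rw [map_add, map_smul, hfx, hPf, smul_zero, add_zero]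
        · exact hlQ' _ (l.add_mem hxl (l.smul_mem a hPl))
    rw [Finset.sum_congr rfl h1, Finset.sum_add_distrib, Finset.sum_const, Finset.card_univ,
      ← Nat.card_eq_fintype_card, ← hqdef, nsmul_eq_mul, ← Finset.sum_filter, Finset.sum_const,
      nsmul_eq_mul, hlA]
    ring
  have hsum := hτ.sum_incidenceDegree_line hV hQ hN (x := x) (P := P.rep) (hlQ' x hxl) hfx
    P.rep_nonzero hPQ hPf (hl.2 x hxl _ hPl)
  have hs0 : s ≠ 0 := by
    rintro rfl
    have : (8 : ℤ) ≤ q := by exact_mod_cast hq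
    omega
  have hPT : P ∈ T ↔ ∃ t : T, P.rep ∈ Submodule.span F {τ t} := by
    constructor
    · intro h
      exact ⟨⟨P, h⟩, Submodule.mem_span_singleton_self _⟩
    · rintro ⟨t, ht⟩
      obtain ⟨a, ha⟩ := Submodule.mem_span_singleton.1 ht
      have : P = t.1 := by
        rw [← P.mk_rep, ← t.1.mk_rep]
        exact (Projectivization.mk_eq_mk_iff' F _ _ _ _).2 ⟨a, ha⟩
      rw [this]
      exact t.2
  constructor
  · intro h
    have h1 := hsum.1 (hPT.1 h)
    have h2 : ∑ a : F, (incidenceDegree R (x + a • P.rep) : ℤ) = q ^ 2 + q := by exact_mod_cast h1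
    rw [hsumdeg] at h2
    apply mul_left_cancel₀ hs0
    linear_combination h2
  · intro h
    have h1 := hsum.2 fun t ht => h (hPT.2 ⟨t, ht⟩)
    have h2 : ∑ a : F, (incidenceDegree R (x + a • P.rep) : ℤ) + q = q ^ 2 := by exact_mod_cast h1
    rw [hsumdeg] at h2
    apply mul_left_cancel₀ hs0
    -- Here 2sk = qs - 2q, and 2q = s² allows s to be cancelled.
    linear_combination h2 + hs

end OrbitsOnLines

/-! ### The Suzuki-Tits ovoid and generators of the Suzuki group in coordinates -/

section TitsCoordinates

variable {F : Type*} [Field F]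

/-- The fourth coordinate `xy + x^(σ+2) + y^σ` of a point of the Tits ovoid, for `σ = 2θ`. -/
def titsZ (θ : F →+* F) (x y : F) : F := x * y + θ x ^ 2 * x ^ 2 + θ y ^ 2

/-- The square root of `x^(σ+2) + y^σ`. -/
def titsW (θ : F →+* F) (x y : F) : F := θ x * x + θ y

/-- The affine points of the Suzuki-Tits ovoid. -/
def titsVec (θ : F →+* F) (x y : F) : Fin 6 → F := ![1, x, y, titsZ θ x y, titsW θ x y, 0]

/-- The point at infinity of the Suzuki-Tits ovoid. -/
def titsInf (F : Type*) [Field F] : Fin 6 → F := ![0, 0, 0, 1, 0, 0]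

/-- The normal form of a quadratic form around the parabolic quadric `X₀X₃ + X₁X₂ + X₄² = 0`. -/
def stdForm (γ : F) (v : Fin 6 → F) : F := v 0 * v 3 + v 1 * v 2 + v 4 ^ 2 + v 5 * v 4 + γ * v 5 ^ 2

/-- The translation of the Suzuki group taking the affine point `(0, 0)` to `(a, b)`. -/
def titsTranslation (θ : F →+* F) (a b : F) : (Fin 6 → F) →ₗ[F] (Fin 6 → F) where
  -- The terms in `v 5` extend the map from N^⊥ to an isometry of the whole space: they cancel what
  -- the change of `v 4` adds to `v 5 * v 4`.
  toFun v := ![v 0, v 1 + a * v 0, v 2 + θ a ^ 2 * v 1 + b * v 0 + θ a * v 5,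
    v 3 + (b + a * θ a ^ 2) * v 1 + a * v 2 + titsZ θ a b * v 0 + θ b * v 5,
    v 4 + θ a * v 1 + titsW θ a b * v 0, v 5]
  map_add' v w := by
    ext i
    fin_cases i <;> simp <;> ring
  map_smul' c v := by
    ext i
    fin_cases i <;> simp <;> ring

/-- The diagonal elements of the Suzuki group. -/
def titsTorus (θ : F →+* F) (κ : F) : (Fin 6 → F) →ₗ[F] (Fin 6 → F) where
  toFun v := ![(κ * θ κ)⁻¹ * v 0, (θ κ)⁻¹ * v 1, θ κ * v 2, κ * θ κ * v 3, v 4, v 5]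
  map_add' v w := by
    ext i
    fin_cases i <;> simp <;> ring
  map_smul' c v := by
    ext i
    fin_cases i <;> simp <;> ring

/-- The involution of the Suzuki group that interchanges the origin and the point at infinity. -/
def titsInversion (F : Type*) [Field F] : (Fin 6 → F) →ₗ[F] (Fin 6 → F) where
  toFun v := ![v 3, v 2, v 1, v 0, v 4, v 5]
  map_add' v w := by
    ext i
    fin_cases i <;> simp
  map_smul' c v := by
    ext i
    fin_cases i <;> simp

variable {θ : F →+* F}

theorem stdForm_titsTranslation [CharP F 2] (γ a b : F) (v : Fin 6 → F) :
    stdForm γ (titsTranslation θ a b v) = stdForm γ v := by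
  have h2 : (2 : F) = 0 := CharTwo.two_eq_zero
  simp [stdForm, titsTranslation, titsZ, titsW]
  grind

theorem stdForm_titsTorus (γ : F) {κ : F} (hκ : κ ≠ 0) (v : Fin 6 → F) :
    stdForm γ (titsTorus θ κ v) = stdForm γ v := by
  have h : θ κ ≠ 0 := (map_ne_zero θ).2 hκ
  simp [stdForm, titsTorus]
  field_simp

theorem stdForm_titsInversion (γ : F) (v : Fin 6 → F) :
    stdForm γ (titsInversion F v) = stdForm γ v := by
  simp [stdForm, titsInversion]
  ring

theorem titsTranslation_titsVec [CharP F 2] (hθ : ∀ x, θ (θ x) ^ 2 = x) (a b x y : F) :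
    titsTranslation θ a b (titsVec θ x y) = titsVec θ (x + a) (y + b + θ a ^ 2 * x) := by
  have h2 : (2 : F) = 0 := CharTwo.two_eq_zero
  have ha := hθ a
  ext i
  fin_cases i <;> simp [titsTranslation, titsVec, titsZ, titsW] <;> grind

theorem titsTranslation_titsInf (a b : F) : titsTranslation θ a b (titsInf F) = titsInf F := by
  ext i
  fin_cases i <;> simp [titsTranslation, titsInf]

theorem titsTorus_titsVec (hθ : ∀ x, θ (θ x) ^ 2 = x) {κ : F} (hκ : κ ≠ 0) (x y : F) :
    titsTorus θ κ (titsVec θ x y) =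
      (κ * θ κ)⁻¹ • titsVec θ (κ * x) (κ * θ κ ^ 2 * y) := by
  have h : θ κ ≠ 0 := (map_ne_zero θ).2 hκ
  have ha := hθ κ
  ext i
  fin_cases i <;> simp [titsTorus, titsVec, titsZ, titsW, ha] <;> field_simp

theorem titsTorus_titsInf (κ : F) :
    titsTorus θ κ (titsInf F) = (κ * θ κ) • titsInf F := by
  ext i
  fin_cases i <;> simp [titsTorus, titsInf]

theorem map_titsZ (hθ : ∀ x, θ (θ x) ^ 2 = x) (x y : F) :
    θ (titsZ θ x y) = θ x * θ y + x * θ x ^ 2 + y := by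
  simp [titsZ, hθ]

/-- Divided by zθ(z), this says that w at (y/z, x/z) equals w(x, y)/z, which is why the inversion
preserves the ovoid. For z = 0 it reduces to yθ(y) = 0 and shows that z vanishes only at the origin.
-/
theorem titsW_mul_map_titsZ [CharP F 2] (hθ : ∀ x, θ (θ x) ^ 2 = x) (x y : F) :
    titsW θ x y * θ (titsZ θ x y) = θ y * y + θ x * titsZ θ x y := by
  have h2 : (2 : F) = 0 := CharTwo.two_eq_zero
  rw [map_titsZ hθ]
  simp only [titsZ, titsW]
  grind

theorem titsZ_eq_zero_iff [CharP F 2] (hθ : ∀ x, θ (θ x) ^ 2 = x) {x y : F} :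
    titsZ θ x y = 0 ↔ x = 0 ∧ y = 0 := by
  constructor
  · intro h
    have h1 := titsW_mul_map_titsZ hθ x y
    rw [h, map_zero, mul_zero, mul_zero, add_zero, eq_comm, mul_eq_zero, map_eq_zero,
      or_self] at h1
    subst h1
    simpa [titsZ] using h
  · rintro ⟨rfl, rfl⟩
    simp [titsZ]

theorem titsInversion_titsVec [CharP F 2] (hθ : ∀ x, θ (θ x) ^ 2 = x) {x y : F}
    (hz : titsZ θ x y ≠ 0) :
    titsInversion F (titsVec θ x y) =
      titsZ θ x y • titsVec θ (y / titsZ θ x y) (x / titsZ θ x y) := by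
  have h2 : (2 : F) = 0 := CharTwo.two_eq_zero
  have hZ : θ (titsZ θ x y) ≠ 0 := (map_ne_zero θ).2 hz
  have h1 := titsW_mul_map_titsZ hθ x y
  have h3 := map_titsZ hθ x y
  have h4 : titsZ θ x y = x * y + titsW θ x y ^ 2 := by
    simp only [titsZ, titsW]; grind
  have hw : titsZ θ x y * titsW θ (y / titsZ θ x y) (x / titsZ θ x y) = titsW θ x y := by
    rw [titsW, map_div₀, map_div₀, eq_div_of_mul_eq hZ h1]
    field_simp
  have hz' : titsZ θ x y * titsZ θ (y / titsZ θ x y) (x / titsZ θ x y) = 1 := by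
    have h5 : ∀ u v, titsZ θ u v = u * v + titsW θ u v ^ 2 := by
      intro u v
      simp only [titsZ, titsW]; grind
    rw [h5 (y / _), eq_div_of_mul_eq hz ((mul_comm _ _).trans hw)]
    field_simp
    rw [mul_comm y x, ← h4]
  ext i
  fin_cases i
  · simp [titsInversion, titsVec]
  · simp [titsInversion, titsVec]; field_simp
  · simp [titsInversion, titsVec]; field_simp
  · simpa [titsInversion, titsVec] using hz'.symm
  · simpa [titsInversion, titsVec] using hw.symm
  · simp [titsInversion, titsVec]

theorem titsInversion_titsVec_zero : titsInversion F (titsVec θ 0 0) = titsInf F := by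
  ext i
  fin_cases i <;> simp [titsInversion, titsVec, titsInf, titsZ, titsW]

theorem titsInversion_titsInf : titsInversion F (titsInf F) = titsVec θ 0 0 := by
  ext i
  fin_cases i <;> simp [titsInversion, titsVec, titsInf, titsZ, titsW]

/-- The left side is the polar form of two affine ovoid points. Being a value of `titsZ`, it
vanishes only if the two points coincide. -/
theorem titsZ_add_titsZ [CharP F 2] (hθ : ∀ x, θ (θ x) ^ 2 = x) (x y x' y' : F) :
    titsZ θ x y + titsZ θ x' y' + x * y' + x' * y =
      titsZ θ (x + x') (y + y' + θ x ^ 2 * (x + x')) := by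
  have h2 : (2 : F) = 0 := CharTwo.two_eq_zero
  have h3 := hθ x
  simp only [titsZ, map_add, map_mul, map_pow, h3]
  grind

end TitsCoordinates

/-! ### The Suzuki group and its transitivity on the ovoid -/

section SuzukiGroup

variable {F V : Type*} [Field F] [AddCommGroup V] [Module F V]

/-- Coordinates of `V` that extend coordinates of `N^⊥` adapted to a Suzuki-Tits ovoid. -/
theorem exists_stdForm_coordinates [CharP F 2] (hV : finrank F V = 6)
    {Q : QuadraticForm F V} (hB : Q.polarBilin.Nondegenerate) {N : V} {e : Fin 5 → V}
    (hN : ∀ i, Q.polarBilin N (e i) = 0)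
    (he : ∀ x : Fin 5 → F, Q (∑ i, x i • e i) = x 0 * x 3 + x 1 * x 2 + x 4 ^ 2) :
    ∃ (γ : F) (Ψ : (Fin 6 → F) ≃ₗ[F] V), (∀ v, Q (Ψ v) = stdForm γ v) ∧
      (∀ x : Fin 5 → F, Ψ ![x 0, x 1, x 2, x 3, x 4, 0] = ∑ i, x i • e i) ∧
      ∃ n, N = Ψ ![0, 0, 0, 0, n, 0] := by
  have hfin : Module.Finite F V := Module.finite_of_finrank_pos (by rw [hV]; norm_num)
  have hB5 : ∀ x y : Fin 5 → F, Q.polarBilin (∑ i, x i • e i) (∑ i, y i • e i) =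
      x 0 * y 3 + x 3 * y 0 + x 1 * y 2 + x 2 * y 1 := by
    intro x y
    have h1 := map_add_polarBilin Q (∑ i, x i • e i) (∑ i, y i • e i)
    have h2 : (∑ i, x i • e i) + ∑ i, y i • e i = ∑ i, (x + y) i • e i := by
      rw [← Finset.sum_add_distrib]
      exact Finset.sum_congr rfl fun i _ => (add_smul _ _ _).symm
    rw [h2, he, he, he] at h1
    simp only [Pi.add_apply] at h1
    linear_combination (x 4 * y 4) * CharTwo.two_eq_zero (R := F) - h1
  have hsingle : ∀ i, e i = ∑ j, (Pi.single i 1 : Fin 5 → F) j • e j := by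
    intro i
    simp [Pi.single_apply]
  have hBe : ∀ i j, Q.polarBilin (e i) (e j) = (!![0, 0, 0, 1, 0; 0, 0, 1, 0, 0; 0, 1, 0, 0, 0;
      1, 0, 0, 0, 0; 0, 0, 0, 0, 0] : Matrix (Fin 5) (Fin 5) F) i j := by
    intro i j
    rw [hsingle i, hsingle j, hB5]
    fin_cases i <;> fin_cases j <;> simp
  have he4 : e 4 ≠ 0 := by
    intro h
    have h1 := he (Pi.single 4 1)
    rw [← hsingle 4, h, Q.map_zero] at h1
    simp at h1
  -- The vector e 4 is orthogonal to every e i, but not to all of V; a sixth basis vector is found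
  -- by pairing with it.
  obtain ⟨u₀, hu₀⟩ : ∃ u, Q.polarBilin (e 4) u = 1 := by
    by_contra! h
    refine he4 (hB.1 (e 4) fun y => ?_)
    by_contra hy
    exact h ((Q.polarBilin (e 4) y)⁻¹ • y) (by rw [map_smul, smul_eq_mul, inv_mul_cancel₀ hy])
  obtain ⟨u, hu⟩ : ∃ u, ∀ i, Q.polarBilin (e i) u = (![0, 0, 0, 0, 1] : Fin 5 → F) i := by
    refine ⟨u₀ - Q.polarBilin (e 3) u₀ • e 0 - Q.polarBilin (e 2) u₀ • e 1 -
      Q.polarBilin (e 1) u₀ • e 2 - Q.polarBilin (e 0) u₀ • e 3, fun i => ?_⟩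
    simp only [map_sub, map_smul, hBe, smul_eq_mul]
    fin_cases i <;> simp [hu₀, -QuadraticMap.polarBilin_apply_apply]
  let Φ : (Fin 6 → F) →ₗ[F] V := Fintype.linearCombination F ![e 0, e 1, e 2, e 3, e 4, u]
  have hΦ : ∀ v, Φ v = (∑ i, (![v 0, v 1, v 2, v 3, v 4] : Fin 5 → F) i • e i) + v 5 • u := by
    intro v
    simp [Φ, Fintype.linearCombination_apply, Fin.sum_univ_succ, add_assoc]
  -- Products with the e i recover every coordinate except `v 4`. This yields injectivity, and also
  -- shows that N, orthogonal to all e i, is a multiple of e 4.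
  have hΦe : ∀ i v, Q.polarBilin (e i) (Φ v) =
      (![v 3, v 2, v 1, v 0, v 5] : Fin 5 → F) i := by
    intro i v
    rw [hΦ, map_add, map_smul, hu, hsingle i, hB5]
    fin_cases i <;> simp
  have hinj : Function.Injective Φ := by
    rw [← LinearMap.ker_eq_bot, LinearMap.ker_eq_bot']
    intro v hv
    have h0 := hΦe 0 v
    have h1 := hΦe 1 v
    have h2 := hΦe 2 v
    have h3 := hΦe 3 v
    have h4 := hΦe 4 v
    rw [hv, map_zero] at h0 h1 h2 h3 h4
    simp at h0 h1 h2 h3 h4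
    rw [hΦ] at hv
    simp [Fin.sum_univ_succ, ← h0, ← h1, ← h2, ← h3, ← h4] at hv
    ext i
    fin_cases i
    exacts [h3.symm, h2.symm, h1.symm, h0.symm, hv.resolve_right he4, h4.symm]
  let Ψ : (Fin 6 → F) ≃ₗ[F] V := LinearMap.linearEquivOfInjective Φ hinj (by rw [hV]; simp)
  have hΨ : ∀ v, Ψ v = Φ v := fun v => rfl
  refine ⟨Q u, Ψ, ?_, ?_, ?_⟩
  · intro v
    rw [hΨ, hΦ, map_add_polarBilin, he, map_smul_form, map_smul, map_sum, LinearMap.sum_apply]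
    simp only [map_smul, LinearMap.smul_apply, hu]
    simp [Fin.sum_univ_succ, stdForm]
    ring
  · intro x
    rw [hΨ, hΦ]
    simp [Fin.sum_univ_succ]
  · obtain ⟨v, hv⟩ := Ψ.surjective N
    refine ⟨v 4, ?_⟩
    rw [← hv]
    congr 1
    have h : ∀ i, (![v 3, v 2, v 1, v 0, v 5] : Fin 5 → F) i = 0 := by
      intro i
      rw [← hΦe i v, ← hΨ, hv, polarBilin_comm, hN]
    ext i
    fin_cases i
    exacts [h 3, h 2, h 1, h 0, rfl, h 4]

/-- The Suzuki-Tits ovoid in the coordinates `Ψ`. -/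
def titsSet (θ : F →+* F) : Set (Fin 6 → F) := insert (titsInf F) {v | ∃ x y, v = titsVec θ x y}

theorem titsSet_ne_zero {θ : F →+* F} {v : Fin 6 → F} (hv : v ∈ titsSet θ) : v ≠ 0 := by
  rcases hv with rfl | ⟨x, y, rfl⟩
  · intro h
    simpa [titsInf] using congrFun h 3
  · intro h
    simpa [titsVec] using congrFun h 0

/-- The point of `PG(V)` with coordinates `v`. -/
noncomputable def coordPoint (Ψ : (Fin 6 → F) ≃ₗ[F] V) (v : Fin 6 → F) (hv : v ≠ 0) : ℙ F V :=
  Projectivization.mk F (Ψ v) (by simpa using hv)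

theorem coordPoint_eq_iff (Ψ : (Fin 6 → F) ≃ₗ[F] V) {v : Fin 6 → F} (hv : v ≠ 0) (p : ℙ F V) :
    p = coordPoint Ψ v hv ↔ p.submodule = Submodule.span F {Ψ v} := by
  rw [← Projectivization.submodule_injective.eq_iff, coordPoint, Projectivization.submodule_mk]

/-- A linear map that preserves a form with non-degenerate polar form is injective, hence bijective.
As T is finite, mapping T into itself suffices for stabilising it. -/
theorem exists_mem_ovoidStabilizer [Finite F] [Module.Finite F V] {Q : QuadraticForm F V}
    (hB : Q.polarBilin.Nondegenerate) {N : V} {T : Set (ℙ F V)} {γ n : F}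
    {Ψ : (Fin 6 → F) ≃ₗ[F] V} (hΨ : ∀ v, Q (Ψ v) = stdForm γ v)
    (hN : N = Ψ ![0, 0, 0, 0, n, 0]) {θ : F →+* F}
    (hT : ∀ p, p ∈ T ↔ ∃ v, ∃ hv : v ∈ titsSet θ, p = coordPoint Ψ v (titsSet_ne_zero hv))
    {φ : (Fin 6 → F) →ₗ[F] (Fin 6 → F)} (hφ : ∀ v, stdForm γ (φ v) = stdForm γ v)
    (hφN : φ ![0, 0, 0, 0, n, 0] = ![0, 0, 0, 0, n, 0])
    (hφT : ∀ v ∈ titsSet θ, ∃ c : F, ∃ w ∈ titsSet θ, φ v = c • w) :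
    ∃ g ∈ ovoidStabilizer Q N T, ∀ v, g (Ψ v) = Ψ (φ v) := by
  have hfinV : Finite V := Module.finite_of_finite F
  have hfinP : Finite (ℙ F V) := Quotient.finite _
  let ψ : V →ₗ[F] V := Ψ.toLinearMap ∘ₗ φ ∘ₗ Ψ.symm.toLinearMap
  have hψ : ∀ v, ψ (Ψ v) = Ψ (φ v) := fun v => by simp [ψ]
  have hψQ : ∀ x, Q (ψ x) = Q x := by
    intro x
    obtain ⟨v, rfl⟩ := Ψ.surjective x
    rw [hψ, hΨ, hΨ, hφ]
  have hinj : Function.Injective ψ := by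
    rw [← LinearMap.ker_eq_bot, LinearMap.ker_eq_bot']
    intro x hx
    refine hB.1 x fun y => ?_
    rw [← polarBilin_isometry (map_add ψ) hψQ, hx, map_zero, LinearMap.zero_apply]
  let g : V ≃ₗ[F] V := LinearEquiv.ofInjectiveEndo ψ hinj
  have hg : ∀ v, g (Ψ v) = Ψ (φ v) := hψ
  refine ⟨g, Subgroup.mem_inf.2 ⟨Subgroup.mem_inf.2 ⟨hψQ, ?_⟩, ?_⟩, hg⟩
  · rw [MulAction.mem_stabilizer_iff, LinearEquiv.smul_def, hN, hg, hφN]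
  · rw [MulAction.mem_stabilizer_set_iff_smul_set_subset (Set.toFinite T)]
    rintro _ ⟨p, hp, rfl⟩
    obtain ⟨v, hv, rfl⟩ := (hT p).1 hp
    obtain ⟨c, w, hw, hvw⟩ := hφT v hv
    refine (hT _).2 ⟨w, hw, ?_⟩
    have h : g (Ψ v) = c • Ψ w := by rw [hg, hvw, map_smul]
    exact (Projectivization.mk_eq_mk_iff' F _ _ _ _).2 ⟨c, h.symm⟩

theorem smul_coordPoint {Ψ : (Fin 6 → F) ≃ₗ[F] V} {g : V ≃ₗ[F] V} {v w : Fin 6 → F} (hv : v ≠ 0)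
    (hw : w ≠ 0) {c : F} (h : g (Ψ v) = Ψ (c • w)) :
    g • coordPoint Ψ v hv = coordPoint Ψ w hw := by
  rw [map_smul] at h
  exact (Projectivization.mk_eq_mk_iff' F _ _ _ _).2 ⟨c, h.symm⟩

theorem coordPoint_rep (Ψ : (Fin 6 → F) ≃ₗ[F] V) {v : Fin 6 → F} (hv : v ≠ 0) :
    ∃ c : F, c ≠ 0 ∧ (coordPoint Ψ v hv).rep = c • Ψ v := by
  obtain ⟨c, hc⟩ := Projectivization.exists_smul_eq_mk_rep F (Ψ v) (by simpa using hv)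
  exact ⟨c, c.ne_zero, hc.symm⟩

/-- The Suzuki-Tits ovoid in coordinates of `V`. -/
theorem IsSuzukiTitsOvoid.exists_coordinates [Finite F] [CharP F 2] (hV : finrank F V = 6)
    {Q : QuadraticForm F V} (hB : Q.polarBilin.Nondegenerate) {N : V} {T : Set (ℙ F V)} {h : ℕ}
    (hq : Nat.card F = 2 ^ (2 * h + 1)) (hT : IsSuzukiTitsOvoid h Q N T) :
    ∃ (γ n : F) (Ψ : (Fin 6 → F) ≃ₗ[F] V) (θ : F →+* F), (∀ x, θ (θ x) ^ 2 = x) ∧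
      (∀ v, Q (Ψ v) = stdForm γ v) ∧ N = Ψ ![0, 0, 0, 0, n, 0] ∧
      ∀ p, p ∈ T ↔ ∃ v, ∃ hv : v ∈ titsSet θ, p = coordPoint Ψ v (titsSet_ne_zero hv) := by
  obtain ⟨e, hNe, he, hTe⟩ := hT
  obtain ⟨γ, Ψ, hΨ, hΨe, n, hn⟩ := exists_stdForm_coordinates hV hB hNe he
  have hθ : ∀ x : F, iterateFrobenius F 2 h x = x ^ 2 ^ h := fun x => iterateFrobenius_def ..
  refine ⟨γ, n, Ψ, iterateFrobenius F 2 h, ?_, hΨ, hn, ?_⟩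
  · intro x
    have := Fintype.ofFinite F
    -- θ is x ↦ x^(2^h), so θ(θ(x))² = x^q = x.
    have hcard : 2 ^ h * (2 ^ h * 2) = Fintype.card F := by
      rw [← Nat.card_eq_fintype_card, hq]
      ring
    rw [hθ, hθ, ← pow_mul, ← pow_mul, hcard, FiniteField.pow_card]
  · have hz : ∀ x y : F, titsZ (iterateFrobenius F 2 h) x y =
        x * y + x ^ (2 ^ (h + 1) + 2) + y ^ 2 ^ (h + 1) := by
      intro x y
      rw [titsZ, hθ, hθ, ← pow_mul, ← pow_mul, ← pow_add, ← pow_succ]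
    have hw : ∀ x y : F, titsW (iterateFrobenius F 2 h) x y = x ^ (2 ^ h + 1) + y ^ 2 ^ h := by
      intro x y
      rw [titsW, hθ, hθ, ← pow_succ]
    intro p
    rw [hTe]
    constructor
    · rintro ⟨v, hv, hp⟩
      rw [← hΨe] at hp
      rcases hv with rfl | ⟨x, y, rfl⟩
      · refine ⟨titsInf F, Or.inl rfl, ?_⟩
        rw [coordPoint_eq_iff, hp]
        rfl
      · refine ⟨titsVec _ x y, Or.inr ⟨x, y, rfl⟩, ?_⟩
        rw [coordPoint_eq_iff, hp, titsVec, hz, hw]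
        rfl
    · rintro ⟨v, hv, hp⟩
      rw [coordPoint_eq_iff] at hp
      rcases hv with rfl | ⟨x, y, rfl⟩
      · refine ⟨_, Or.inl rfl, ?_⟩
        rw [hp, ← hΨe]
        rfl
      · refine ⟨_, Or.inr ⟨x, y, rfl⟩, ?_⟩
        rw [hp, ← hΨe, titsVec, hz, hw]
        rfl

theorem polarBilin_stdForm [CharP F 2] {Q : QuadraticForm F V} {γ : F} {Ψ : (Fin 6 → F) ≃ₗ[F] V}
    (hΨ : ∀ v, Q (Ψ v) = stdForm γ v) (v w : Fin 6 → F) :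
    Q.polarBilin (Ψ v) (Ψ w) = v 0 * w 3 + v 3 * w 0 + v 1 * w 2 + v 2 * w 1 + v 5 * w 4 +
      v 4 * w 5 := by
  have h := map_add_polarBilin Q (Ψ v) (Ψ w)
  rw [← map_add, hΨ, hΨ, hΨ] at h
  simp only [stdForm, Pi.add_apply] at h
  linear_combination -h + (v 4 * w 4 + γ * v 5 * w 5) * CharTwo.two_eq_zero (R := F)

theorem polarBilin_titsSet_ne_zero [CharP F 2] {Q : QuadraticForm F V} {γ : F}
    {Ψ : (Fin 6 → F) ≃ₗ[F] V} (hΨ : ∀ v, Q (Ψ v) = stdForm γ v) {θ : F →+* F}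
    (hθ : ∀ x, θ (θ x) ^ 2 = x) {v w : Fin 6 → F} (hv : v ∈ titsSet θ) (hw : w ∈ titsSet θ)
    (hvw : v ≠ w) : Q.polarBilin (Ψ v) (Ψ w) ≠ 0 := by
  rw [polarBilin_stdForm hΨ]
  rcases hv with rfl | ⟨x, y, rfl⟩ <;> rcases hw with rfl | ⟨x', y', rfl⟩
  · exact absurd rfl hvw
  · simp [titsInf, titsVec]
  · simp [titsInf, titsVec]
  · intro h
    have h1 : titsZ θ x y + titsZ θ x' y' + x * y' + x' * y = 0 := by
      rw [← h]
      simp [titsVec]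
      ring
    rw [titsZ_add_titsZ hθ, titsZ_eq_zero_iff hθ] at h1
    obtain ⟨h2, h3⟩ := h1
    rw [h2, mul_zero, add_zero] at h3
    rw [CharTwo.add_eq_zero] at h2 h3
    exact hvw (by rw [h2, h3])

/-- The Suzuki-Tits ovoid is an ovoid of the parabolic quadric. -/
theorem IsSuzukiTitsOvoid.isOvoid [Finite F] [CharP F 2] (hV : finrank F V = 6)
    {Q : QuadraticForm F V} (hB : Q.polarBilin.Nondegenerate) {N : V} {T : Set (ℙ F V)} {h : ℕ}
    (hq : Nat.card F = 2 ^ (2 * h + 1)) (hT : IsSuzukiTitsOvoid h Q N T) :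
    T ⊆ baseLocus Q N ∧
      (∀ t ∈ T, ∀ t' ∈ T, t ≠ t' → Q.polarBilin t.rep t'.rep ≠ 0) ∧
      T.ncard = Nat.card F ^ 2 + 1 := by
  obtain ⟨γ, n, Ψ, θ, hθ, hΨ, hN, hT⟩ := hT.exists_coordinates hV hB hq
  refine ⟨?_, ?_, ?_⟩
  · intro p hp
    obtain ⟨v, hv, rfl⟩ := (hT p).1 hp
    refine ⟨(mk_mem_quadric _).2 ?_, (mk_mem_pointsOf _).2 ?_⟩
    · rw [hΨ]
      rcases hv with rfl | ⟨x, y, rfl⟩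
      · simp [stdForm, titsInf]
      · have h2 : (2 : F) = 0 := CharTwo.two_eq_zero
        simp [stdForm, titsVec, titsZ, titsW]
        grind
    · rw [LinearMap.mem_ker, hN, polarBilin_stdForm hΨ]
      rcases hv with rfl | ⟨x, y, rfl⟩ <;> simp [titsInf, titsVec]
  · intro t ht t' ht' htt'
    obtain ⟨v, hv, rfl⟩ := (hT t).1 ht
    obtain ⟨w, hw, rfl⟩ := (hT t').1 ht'
    obtain ⟨c, hc, hcv⟩ := coordPoint_rep Ψ (titsSet_ne_zero hv)
    obtain ⟨d, hd, hdw⟩ := coordPoint_rep Ψ (titsSet_ne_zero hw)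
    rw [hcv, hdw, map_smul, map_smul, LinearMap.smul_apply]
    refine smul_ne_zero hd (smul_ne_zero hc (polarBilin_titsSet_ne_zero hΨ hθ hv hw ?_))
    rintro rfl
    exact htt' rfl
  · have h1 : (titsSet θ).ncard = T.ncard := by
      refine Set.ncard_congr (fun v hv => coordPoint Ψ v (titsSet_ne_zero hv)) ?_ ?_ ?_
      · intro v hv
        exact (hT _).2 ⟨v, hv, rfl⟩
      · intro v w hv hw hvw
        by_contra hne
        refine polarBilin_titsSet_ne_zero hΨ hθ hv hw hne ?_
        obtain ⟨a, ha⟩ := (Projectivization.mk_eq_mk_iff' F _ _ _ _).1 hvw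
        rw [← ha, map_smul, LinearMap.smul_apply, polarBilin_self, smul_zero]
      · intro p hp
        obtain ⟨v, hv, rfl⟩ := (hT p).1 hp
        exact ⟨v, hv, rfl⟩
    have h2 : {v | ∃ x y, v = titsVec θ x y} = Set.range fun z : F × F => titsVec θ z.1 z.2 := by
      ext v
      simp [eq_comm]
    have h3 : Function.Injective fun z : F × F => titsVec θ z.1 z.2 := by
      rintro ⟨x, y⟩ ⟨x', y'⟩ h
      have h4 := congrFun h 1
      have h5 := congrFun h 2
      simp [titsVec] at h4 h5
      rw [h4, h5]
    have h6 : titsInf F ∉ {v | ∃ x y, v = titsVec θ x y} := by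
      rintro ⟨x, y, h⟩
      simpa [titsInf, titsVec] using congrFun h 0
    rw [← h1, titsSet, Set.ncard_insert_of_notMem h6 (Set.toFinite _), h2, ← Set.image_univ,
      Set.ncard_image_of_injective _ h3, Set.ncard_univ, Nat.card_prod, sq]

/-- The Suzuki group is transitive on the Suzuki-Tits ovoid. -/
theorem IsSuzukiTitsOvoid.exists_smul_eq [Finite F] [CharP F 2] (hV : finrank F V = 6)
    {Q : QuadraticForm F V} (hB : Q.polarBilin.Nondegenerate) {N : V} {T : Set (ℙ F V)} {h : ℕ}
    (hq : Nat.card F = 2 ^ (2 * h + 1)) (hh : 0 < h) (hT : IsSuzukiTitsOvoid h Q N T) :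
    ∀ t ∈ T, ∀ t' ∈ T, ∃ g ∈ suzukiGroup Q N T, g • t = t' := by
  have hfin : Module.Finite F V := Module.finite_of_finrank_pos (by rw [hV]; norm_num)
  obtain ⟨γ, n, Ψ, θ, hθ, hΨ, hN, hTmem⟩ := hT.exists_coordinates hV hB hq
  set H := ovoidStabilizer Q N T with hH
  set G := suzukiGroup Q N T with hG
  have hGH : ∀ a ∈ H, ∀ b ∈ H, a * b * a⁻¹ * b⁻¹ ∈ G := fun a ha b hb =>
    Subgroup.commutator_mem_commutator ha hb
  have hGle : G ≤ H := Subgroup.commutator_le_self H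
  let pt : F → F → ℙ F V := fun x y => coordPoint Ψ (titsVec θ x y)
    (titsSet_ne_zero (Or.inr ⟨x, y, rfl⟩))
  let inf : ℙ F V := coordPoint Ψ (titsInf F) (titsSet_ne_zero (Or.inl rfl : _ ∈ titsSet θ))
  have hTpt : ∀ t ∈ T, t = inf ∨ ∃ x y, t = pt x y := by
    intro t ht
    obtain ⟨v, hv, rfl⟩ := (hTmem t).1 ht
    rcases hv with rfl | ⟨x, y, rfl⟩
    · exact Or.inl rfl
    · exact Or.inr ⟨x, y, rfl⟩
  have hself : ∀ v ∈ titsSet θ, ∃ c : F, ∃ w ∈ titsSet θ, v = c • w := fun v hv =>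
    ⟨1, v, hv, (one_smul _ _).symm⟩
  have htrans : ∀ a b, ∃ g ∈ H, ∀ x y, g • pt x y = pt (x + a) (y + b + θ a ^ 2 * x) := by
    intro a b
    obtain ⟨g, hg, hgv⟩ := exists_mem_ovoidStabilizer hB hΨ hN hTmem
      (φ := titsTranslation θ a b) (stdForm_titsTranslation γ a b)
      (by ext i; fin_cases i <;> simp [titsTranslation]) (by
        rintro v (rfl | ⟨x, y, rfl⟩)
        · rw [titsTranslation_titsInf]
          exact hself _ (Or.inl rfl)
        · rw [titsTranslation_titsVec hθ]
          exact hself _ (Or.inr ⟨_, _, rfl⟩))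
    refine ⟨g, hg, fun x y => smul_coordPoint _ _ (c := 1) ?_⟩
    rw [hgv, titsTranslation_titsVec hθ, one_smul]
  have htorus : ∀ κ, κ ≠ 0 → ∃ g ∈ H, ∀ x y, g • pt x y = pt (κ * x) (κ * θ κ ^ 2 * y) := by
    intro κ hκ
    obtain ⟨g, hg, hgv⟩ := exists_mem_ovoidStabilizer hB hΨ hN hTmem
      (φ := titsTorus θ κ) (stdForm_titsTorus γ hκ)
      (by ext i; fin_cases i <;> simp [titsTorus]) (by
        rintro v (rfl | ⟨x, y, rfl⟩)
        · exact ⟨_, _, Or.inl rfl, titsTorus_titsInf κ⟩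
        · exact ⟨_, _, Or.inr ⟨_, _, rfl⟩, titsTorus_titsVec hθ hκ x y⟩)
    refine ⟨g, hg, fun x y => smul_coordPoint _ _ (c := (κ * θ κ)⁻¹) ?_⟩
    rw [hgv, titsTorus_titsVec hθ hκ]
  obtain ⟨w, hw, hw0, hwpt⟩ : ∃ w ∈ H, w • pt 0 0 = inf ∧ ∃ x y, w • pt 1 0 = pt x y := by
    obtain ⟨g, hg, hgv⟩ := exists_mem_ovoidStabilizer hB hΨ hN hTmem
      (φ := titsInversion F) (stdForm_titsInversion γ)
      (by ext i; fin_cases i <;> simp [titsInversion]) (by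
        rintro v (rfl | ⟨x, y, rfl⟩)
        · rw [titsInversion_titsInf (θ := θ)]
          exact hself _ (Or.inr ⟨0, 0, rfl⟩)
        · by_cases hz : titsZ θ x y = 0
          · obtain ⟨rfl, rfl⟩ := (titsZ_eq_zero_iff hθ).1 hz
            rw [titsInversion_titsVec_zero]
            exact hself _ (Or.inl rfl)
          · exact ⟨_, _, Or.inr ⟨_, _, rfl⟩, titsInversion_titsVec hθ hz⟩)
    refine ⟨g, hg, smul_coordPoint _ _ (c := 1) ?_,
      0 / titsZ θ 1 0, 1 / titsZ θ 1 0, smul_coordPoint _ _ (c := titsZ θ 1 0) ?_⟩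
    · rw [hgv, titsInversion_titsVec_zero, one_smul]
    · rw [hgv, titsInversion_titsVec hθ]
      rw [Ne, titsZ_eq_zero_iff hθ]
      simp
  -- Here h > 0 matters: over the field of two elements there is no nontrivial diagonal element.
  obtain ⟨κ, hκ0, hκ1⟩ : ∃ κ : F, κ ≠ 0 ∧ κ ≠ 1 := by
    classical
    have := Fintype.ofFinite F
    have h1 : ({0, 1} : Finset F).card < Fintype.card F := by
      refine lt_of_le_of_lt Finset.card_le_two ?_
      rw [← Nat.card_eq_fintype_card, hq]
      exact lt_of_lt_of_le (by norm_num) (Nat.pow_le_pow_right (by norm_num)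
        (by omega : 3 ≤ 2 * h + 1))
    obtain ⟨κ, hκ⟩ := Finset.exists_mem_notMem_of_card_lt_card
      (by rwa [← Finset.card_univ] at h1)
    exact ⟨κ, by simpa using hκ.2⟩
  -- Applying θ to κθ(κ)² = 1 gives κθ(κ) = 1, whence θ(κ) = 1.
  have hκ2 : κ * θ κ ^ 2 ≠ 1 := by
    intro h1
    have h2 := congrArg θ h1
    rw [map_mul, map_pow, hθ, map_one] at h2
    have h3 : θ κ = 1 := by
      calc θ κ = θ κ * (θ κ * κ) := by rw [h2, mul_one]
        _ = κ * θ κ ^ 2 := by ring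
        _ = 1 := h1
    exact hκ1 (θ.injective (by rw [h3, map_one]))
  have haff : ∀ x y, ∃ g ∈ G, g • pt 0 0 = pt x y := by
    intro x y
    obtain ⟨k, hk, hkpt⟩ := htorus κ hκ0
    have h1 : 1 - κ ≠ 0 := sub_ne_zero.2 hκ1.symm
    have h2 : 1 - κ * θ κ ^ 2 ≠ 0 := sub_ne_zero.2 hκ2.symm
    have hθκ : θ κ ≠ 0 := (map_ne_zero θ).2 hκ0
    -- With k the diagonal element of κ, τ the translation by (a, b) and μ = κθ(κ)², the commutator
    -- k τ⁻¹ k⁻¹ τ sends the origin to (a - κa, b - μb - μθ(a)²(a/κ - a)). The values of a and b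
    -- solve for (x, y).
    set a := x / (1 - κ) with ha
    set b := (y + κ * θ κ ^ 2 * (θ a ^ 2 * (a / κ - a))) / (1 - κ * θ κ ^ 2) with hb
    obtain ⟨τ, hτ, hτpt⟩ := htrans a b
    have hkinv : ∀ u v, k⁻¹ • pt (κ * u) (κ * θ κ ^ 2 * v) = pt u v := fun u v => by
      rw [← hkpt, inv_smul_smul]
    have hτinv : ∀ u v, τ⁻¹ • pt (u + a) (v + b + θ a ^ 2 * u) = pt u v := fun u v => by
      rw [← hτpt, inv_smul_smul]
    refine ⟨k * τ⁻¹ * k⁻¹ * τ⁻¹⁻¹, hGH k hk τ⁻¹ (H.inv_mem hτ), ?_⟩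
    rw [inv_inv, mul_smul, mul_smul, mul_smul, hτpt]
    have e1 : (0 : F) + a = κ * (a / κ) := by field_simp; ring
    have e2 : (0 : F) + b + θ a ^ 2 * 0 = κ * θ κ ^ 2 * (b / (κ * θ κ ^ 2)) := by
      field_simp; ring
    rw [e1, e2, hkinv]
    have e3 : a / κ = (a / κ - a) + a := by ring
    have e4 : b / (κ * θ κ ^ 2) = (b / (κ * θ κ ^ 2) - b - θ a ^ 2 * (a / κ - a)) + b +
        θ a ^ 2 * (a / κ - a) := by ring
    have e5 := hτinv (a / κ - a) (b / (κ * θ κ ^ 2) - b - θ a ^ 2 * (a / κ - a))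
    rw [← e3, ← e4] at e5
    rw [e5, hkpt]
    have e6 : κ * (a / κ - a) = x := by
      have : a * (1 - κ) = x := div_mul_cancel₀ _ h1
      rw [← this]
      field_simp
    have e7 : κ * θ κ ^ 2 * (b / (κ * θ κ ^ 2) - b - θ a ^ 2 * (a / κ - a)) = y := by
      have h3 : b * (1 - κ * θ κ ^ 2) = y + κ * θ κ ^ 2 * (θ a ^ 2 * (a / κ - a)) :=
        div_mul_cancel₀ _ h2
      have h4 : κ * θ κ ^ 2 * (b / (κ * θ κ ^ 2)) = b := by field_simp
      linear_combination h4 + h3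
    rw [e6, e7]
  have hinf : ∃ g ∈ G, g • pt 0 0 = inf := by
    obtain ⟨x, y, hxy⟩ := hwpt
    obtain ⟨g, hg, hgpt⟩ := haff 1 0
    obtain ⟨g', hg', hgpt'⟩ := haff x y
    -- The conjugate equals [w, g]g. It moves the point at infinity to an affine point, which the
    -- commutators above already reach from the origin.
    have hconj : w * g * w⁻¹ ∈ G := by
      have := G.mul_mem (hGH w hw g (hGle hg)) hg
      rwa [inv_mul_cancel_right] at this
    refine ⟨(w * g * w⁻¹)⁻¹ * g', G.mul_mem (G.inv_mem hconj) hg', ?_⟩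
    rw [mul_smul, inv_smul_eq_iff, mul_smul, mul_smul, inv_smul_eq_iff.2 hw0.symm, hgpt, hxy,
      hgpt']
  have hall : ∀ t ∈ T, ∃ g ∈ G, g • pt 0 0 = t := by
    intro t ht
    rcases hTpt t ht with rfl | ⟨x, y, rfl⟩
    · exact hinf
    · exact haff x y
  intro t ht t' ht'
  obtain ⟨g, hg, hgt⟩ := hall t ht
  obtain ⟨g', hg', hgt'⟩ := hall t' ht'
  exact ⟨g' * g⁻¹, G.mul_mem hg' (G.inv_mem hg), by rw [mul_smul, ← hgt, inv_smul_smul, hgt']⟩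

end SuzukiGroup

/-! ### The pencil of quadrics and isotropic lines -/

section Pencil

variable {F V : Type*} [Field F] [AddCommGroup V] [Module F V]

theorem pencilForm_apply (Q : QuadraticForm F V) (N : V) (c : F) (x : V) :
    pencilForm Q N c x = Q x + c * Q.polarBilin N x ^ 2 := by
  rw [sq]
  rfl

/-- The polar form of c f² is 2c f(x)f(y), which is zero in characteristic 2. -/
theorem polarBilin_pencilForm [CharP F 2] (Q : QuadraticForm F V) (N : V) (c : F) :
    (pencilForm Q N c).polarBilin = Q.polarBilin := by
  ext x y
  have h := map_add_polarBilin (pencilForm Q N c) x y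
  simp only [pencilForm_apply, map_add_polarBilin Q x y, map_add] at h
  linear_combination -h + c * Q.polarBilin N x * Q.polarBilin N y * CharTwo.two_eq_zero (R := F)

theorem pencilForm_self [CharP F 2] (Q : QuadraticForm F V) (N : V) (c : F) :
    pencilForm Q N c N = Q N := by
  rw [pencilForm_apply, polarBilin_self, zero_pow two_ne_zero, mul_zero, add_zero]

theorem mem_baseLocus_iff_rep {Q : QuadraticForm F V} {N : V} {p : ℙ F V} :
    p ∈ baseLocus Q N ↔ Q p.rep = 0 ∧ Q.polarBilin N p.rep = 0 := by
  rw [baseLocus, Set.mem_inter_iff, mem_quadric_iff_rep, mem_pointsOf_iff_rep, LinearMap.mem_ker]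

theorem baseLocus_pencilForm [CharP F 2] (Q : QuadraticForm F V) (N : V) (c : F) :
    baseLocus (pencilForm Q N c) N = baseLocus Q N := by
  ext p
  rw [mem_baseLocus_iff_rep, mem_baseLocus_iff_rep, polarBilin_pencilForm, pencilForm_apply]
  refine and_congr_left fun h => ?_
  rw [h, zero_pow two_ne_zero, mul_zero, add_zero]

theorem baseLocus_subset_quadric_pencilForm [CharP F 2] (Q : QuadraticForm F V) (N : V) (c : F) :
    baseLocus Q N ⊆ quadric (pencilForm Q N c) := by
  rw [← baseLocus_pencilForm Q N c]
  exact Set.inter_subset_left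

theorem polarBilin_rep_eq_zero_of_mem_quadric_of_mem_quadric {Q : QuadraticForm F V} {N : V}
    {c d : F} (hcd : c ≠ d) {p : ℙ F V} (hc : p ∈ quadric (pencilForm Q N c))
    (hd : p ∈ quadric (pencilForm Q N d)) : Q.polarBilin N p.rep = 0 := by
  rw [mem_quadric_iff_rep, pencilForm_apply] at hc hd
  have h : (c - d) * Q.polarBilin N p.rep ^ 2 = 0 := by linear_combination hc - hd
  exact pow_eq_zero_iff two_ne_zero |>.1 ((mul_eq_zero.1 h).resolve_left (sub_ne_zero.2 hcd))

/-- Two quadrics of the pencil meet in the base locus. -/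
theorem quadric_inter_quadric {Q : QuadraticForm F V} {N : V} [CharP F 2] {c d : F} (hcd : c ≠ d) :
    quadric (pencilForm Q N c) ∩ quadric (pencilForm Q N d) = baseLocus Q N := by
  ext p
  constructor
  · rintro ⟨hc, hd⟩
    have h := polarBilin_rep_eq_zero_of_mem_quadric_of_mem_quadric hcd hc hd
    rw [mem_quadric_iff_rep, pencilForm_apply, h, zero_pow two_ne_zero, mul_zero, add_zero] at hc
    exact mem_baseLocus_iff_rep.2 ⟨hc, h⟩
  · intro h
    exact ⟨baseLocus_subset_quadric_pencilForm Q N c h, baseLocus_subset_quadric_pencilForm Q N d h⟩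

/-- Inside one quadric of the pencil, the line meets the other one exactly in the base locus. That
is a single point unless the line lies in both quadrics, which would put it in N^⊥. For the same
reason the line has no point of `A'`. -/
theorem ncard_line_inter_of_subset_quadric [Finite F] [CharP F 2] {Q : QuadraticForm F V}
    {N : V} {c d : F} (hcd : c ≠ d) {A A' : Set (ℙ F V)}
    (hA : A ⊆ quadric (pencilForm Q N c) \ baseLocus Q N)
    (hA' : A' ⊆ quadric (pencilForm Q N d) \ baseLocus Q N) {l : Submodule F V}
    (hl : IsPolarLine Q.polarBilin l) (hlf : ¬ l ≤ LinearMap.ker (Q.polarBilin N))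
    (hlc : pointsOf l ⊆ quadric (pencilForm Q N c)) :
    (pointsOf l ∩ baseLocus Q N).ncard = 1 ∧
      (pointsOf l ∩ (A ∪ A' ∪ baseLocus Q N)).ncard = (pointsOf l ∩ A).ncard + 1 := by
  have hfin : (pointsOf l).Finite := Set.finite_of_ncard_ne_zero (by
    rw [ncard_pointsOf_of_finrank_two hl.1]; omega)
  have hbase : pointsOf l ∩ baseLocus Q N = pointsOf l ∩ quadric (pencilForm Q N d) := by
    rw [← quadric_inter_quadric hcd, ← Set.inter_assoc, Set.inter_eq_left.2 hlc]
  have h1 : (pointsOf l ∩ baseLocus Q N).ncard = 1 := by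
    have hl' : IsPolarLine (pencilForm Q N d).polarBilin l := by rwa [polarBilin_pencilForm]
    rcases polarLine_subset_or_tangent hl' with h | h
    · exfalso
      rw [← pointsOf_subset_iff] at hlf
      refine hlf fun p hp => mem_pointsOf_iff_rep.2 ?_
      exact polarBilin_rep_eq_zero_of_mem_quadric_of_mem_quadric hcd (hlc hp) (h hp)
    · rw [hbase, h]
  refine ⟨h1, ?_⟩
  have h2 : pointsOf l ∩ (A ∪ A' ∪ baseLocus Q N) =
      (pointsOf l ∩ A) ∪ (pointsOf l ∩ baseLocus Q N) := by
    ext p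
    constructor
    · rintro ⟨hp, (h | h) | h⟩
      · exact Or.inl ⟨hp, h⟩
      · exact absurd (hbase.ge ⟨hp, (hA' h).1⟩).2 (hA' h).2
      · exact Or.inr ⟨hp, h⟩
    · rintro (⟨hp, h⟩ | ⟨hp, h⟩)
      · exact ⟨hp, Or.inl (Or.inl h)⟩
      · exact ⟨hp, Or.inr h⟩
  have h3 : Disjoint (pointsOf l ∩ A) (pointsOf l ∩ baseLocus Q N) :=
    Set.disjoint_left.2 fun p hp hp' => (hA hp.2).2 hp'.2
  rw [h2, Set.ncard_union_eq h3 (hfin.subset Set.inter_subset_left)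
    (hfin.subset Set.inter_subset_left), h1]

/-- The ways in which a totally isotropic line meets the union of the base locus and subsets of two
quadrics of the pencil. -/
theorem polarLine_inter_cases [Finite F] [CharP F 2] {Q : QuadraticForm F V}
    {N : V} {c d : F} (hcd : c ≠ d) {A A' : Set (ℙ F V)}
    (hA : A ⊆ quadric (pencilForm Q N c) \ baseLocus Q N)
    (hA' : A' ⊆ quadric (pencilForm Q N d) \ baseLocus Q N) {l : Submodule F V}
    (hl : IsPolarLine Q.polarBilin l) :
    (pointsOf l ⊆ baseLocus Q N ∧
      (pointsOf l ∩ (A ∪ A' ∪ baseLocus Q N)).ncard = Nat.card F + 1) ∨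
    (¬ pointsOf l ⊆ quadric (pencilForm Q N c) ∧ ¬ pointsOf l ⊆ quadric (pencilForm Q N d) ∧
      (pointsOf l ∩ (A ∪ A' ∪ baseLocus Q N)).ncard ≤ 2) ∨
    (pointsOf l ⊆ quadric (pencilForm Q N c) ∧ (pointsOf l ∩ baseLocus Q N).ncard = 1 ∧
      (pointsOf l ∩ (A ∪ A' ∪ baseLocus Q N)).ncard = (pointsOf l ∩ A).ncard + 1) ∨
    (pointsOf l ⊆ quadric (pencilForm Q N d) ∧ (pointsOf l ∩ baseLocus Q N).ncard = 1 ∧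
      (pointsOf l ∩ (A ∪ A' ∪ baseLocus Q N)).ncard = (pointsOf l ∩ A').ncard + 1) := by
  have hcard := ncard_pointsOf_of_finrank_two hl.1
  have hfin : (pointsOf l).Finite := Set.finite_of_ncard_ne_zero (by rw [hcard]; omega)
  have hl' : ∀ b, IsPolarLine (pencilForm Q N b).polarBilin l := fun b => by
    rwa [polarBilin_pencilForm]
  by_cases hb : pointsOf l ⊆ baseLocus Q N
  · refine Or.inl ⟨hb, ?_⟩
    rw [Set.inter_eq_left.2 (hb.trans Set.subset_union_right), hcard]
  -- Within N^⊥ all quadrics of the pencil agree, so a line there that is not in the base locus has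
  -- only one point on any of them.
  by_cases hlf : l ≤ LinearMap.ker (Q.polarBilin N)
  · have hsub : ∀ b, pointsOf l ∩ quadric (pencilForm Q N b) ⊆ baseLocus Q N := by
      rintro b p ⟨hp, hpb⟩
      rw [← baseLocus_pencilForm Q N b, baseLocus, polarBilin_pencilForm]
      exact ⟨hpb, pointsOf_subset_iff.2 hlf hp⟩
    have hnot : ∀ b, ¬ pointsOf l ⊆ quadric (pencilForm Q N b) := fun b h =>
      hb fun p hp => hsub b ⟨hp, h hp⟩
    refine Or.inr (Or.inl ⟨hnot c, hnot d, ?_⟩)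
    have h1 : pointsOf l ∩ (A ∪ A' ∪ baseLocus Q N) ⊆
        pointsOf l ∩ quadric (pencilForm Q N c) := by
      rintro p ⟨hp, (h | h) | h⟩
      · exact ⟨hp, (hA h).1⟩
      · exact absurd (hsub d ⟨hp, (hA' h).1⟩) (hA' h).2
      · exact ⟨hp, baseLocus_subset_quadric_pencilForm Q N c h⟩
    refine (Set.ncard_le_ncard h1 (hfin.subset Set.inter_subset_left)).trans ?_
    rw [(polarLine_subset_or_tangent (hl' c)).resolve_left (hnot c)]
    norm_num
  right
  by_cases hc : pointsOf l ⊆ quadric (pencilForm Q N c)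
  · exact Or.inr (Or.inl ⟨hc, ncard_line_inter_of_subset_quadric hcd hA hA' hl hlf hc⟩)
  by_cases hd : pointsOf l ⊆ quadric (pencilForm Q N d)
  · refine Or.inr (Or.inr ⟨hd, ?_⟩)
    rw [Set.union_comm A A']
    exact ncard_line_inter_of_subset_quadric hcd.symm hA' hA hl hlf hd
  refine Or.inl ⟨hc, hd, ?_⟩
  have h1 : pointsOf l ∩ (A ∪ A' ∪ baseLocus Q N) ⊆
      (pointsOf l ∩ quadric (pencilForm Q N c)) ∪ (pointsOf l ∩ quadric (pencilForm Q N d)) := by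
    rintro p ⟨hp, (h | h) | h⟩
    · exact Or.inl ⟨hp, (hA h).1⟩
    · exact Or.inr ⟨hp, (hA' h).1⟩
    · exact Or.inl ⟨hp, baseLocus_subset_quadric_pencilForm Q N c h⟩
  refine (Set.ncard_le_ncard h1 ((hfin.subset Set.inter_subset_left).union
    (hfin.subset Set.inter_subset_left))).trans ((Set.ncard_union_le _ _).trans ?_)
  rw [(polarLine_subset_or_tangent (hl' c)).resolve_left hc,
    (polarLine_subset_or_tangent (hl' d)).resolve_left hd]

/-- A line inside the union has q + 1 > 2 points in it, and the two bounds exclude lines of a single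
quadric. Only the lines of the base locus remain. -/
theorem ncard_polarLines_subset [Finite F] [CharP F 2] (hV : finrank F V = 6)
    {Q : QuadraticForm F V} (hB : Q.polarBilin.Nondegenerate) {N : V} (hN : Q N ≠ 0) {c d : F}
    (hcd : c ≠ d) {A A' : Set (ℙ F V)}
    (hA : A ⊆ quadric (pencilForm Q N c) \ baseLocus Q N)
    (hA' : A' ⊆ quadric (pencilForm Q N d) \ baseLocus Q N)
    (hlA : ∀ l, IsPolarLine Q.polarBilin l → pointsOf l ⊆ quadric (pencilForm Q N c) →
      (pointsOf l ∩ baseLocus Q N).ncard = 1 → (pointsOf l ∩ A).ncard < Nat.card F)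
    (hlA' : ∀ l, IsPolarLine Q.polarBilin l → pointsOf l ⊆ quadric (pencilForm Q N d) →
      (pointsOf l ∩ baseLocus Q N).ncard = 1 → (pointsOf l ∩ A').ncard < Nat.card F) :
    {l : Submodule F V | IsPolarLine Q.polarBilin l ∧
      pointsOf l ⊆ A ∪ A' ∪ baseLocus Q N}.ncard = (Nat.card F + 1) * (Nat.card F ^ 2 + 1) := by
  rw [← ncard_singular_lines hV hB hN]
  congr 1
  ext l
  refine and_congr_right fun hl => ?_
  have hbase : pointsOf l ⊆ baseLocus Q N ↔ ∀ x ∈ l, Q x = 0 ∧ Q.polarBilin N x = 0 := by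
    rw [baseLocus, Set.subset_inter_iff, pointsOf_subset_quadric_iff, pointsOf_subset_iff]
    exact ⟨fun h x hx => ⟨h.1 x hx, h.2 hx⟩, fun h => ⟨fun x hx => (h x hx).1,
      fun x hx => (h x hx).2⟩⟩
  rw [← hbase]
  refine ⟨fun h => ?_, fun h => h.trans Set.subset_union_right⟩
  have hq1 : 1 < Nat.card F := Finite.one_lt_card
  have hcount : (pointsOf l ∩ (A ∪ A' ∪ baseLocus Q N)).ncard = Nat.card F + 1 := by
    rw [Set.inter_eq_left.2 h, ncard_pointsOf_of_finrank_two hl.1]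
  rcases polarLine_inter_cases hcd hA hA' hl with h1 | ⟨-, -, h1⟩ | ⟨h1, h2, h3⟩ | ⟨h1, h2, h3⟩
  · exact h1.1
  · omega
  · have := hlA l hl h1 h2
    omega
  · have := hlA' l hl h1 h2
    omega

theorem pencilForm_isometry {Q : QuadraticForm F V} {N : V} (c : F) {g : V ≃ₗ[F] V}
    (hg : ∀ x, Q (g x) = Q x) (hN : g N = N) (x : V) :
    pencilForm Q N c (g x) = pencilForm Q N c x := by
  have h := polarBilin_isometry (map_add g) hg N x
  rw [hN] at h
  rw [pencilForm_apply, pencilForm_apply, hg, h]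

theorem ovoidStabilizer_spec {Q : QuadraticForm F V} {N : V} {T : Set (ℙ F V)} {g : V ≃ₗ[F] V}
    (hg : g ∈ ovoidStabilizer Q N T) :
    (∀ x, Q (g x) = Q x) ∧ g N = N ∧ ∀ t ∈ T, g • t ∈ T := by
  obtain ⟨h1, h2⟩ := Subgroup.mem_inf.1 hg
  obtain ⟨h3, h4⟩ := Subgroup.mem_inf.1 h1
  exact ⟨h3, h4, fun t ht => (MulAction.mem_stabilizer_set.1 h2 t).2 ht⟩

theorem smul_mem_quadric {Q : QuadraticForm F V} {g : V ≃ₗ[F] V}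
    (hg : ∀ x, Q (g x) = Q x) {p : ℙ F V} : g • p ∈ quadric Q ↔ p ∈ quadric Q := by
  obtain ⟨c, hc, h⟩ := exists_rep_smul g p
  rw [mem_quadric_iff_rep, mem_quadric_iff_rep, h, map_smul_form, hg, mul_eq_zero,
    or_iff_right (pow_ne_zero 2 hc)]

theorem suzukiOrbit_subset {Q : QuadraticForm F V} {N : V} {T : Set (ℙ F V)} {c : F}
    {A : Set (ℙ F V)} (hA : IsOrbitOn (suzukiGroup Q N T)
      (quadric (pencilForm Q N c) \ baseLocus Q N) A) :
    A ⊆ quadric (pencilForm Q N c) \ baseLocus Q N := by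
  obtain ⟨p, ⟨hp, hpb⟩, rfl⟩ := hA
  rintro _ ⟨⟨g, hg⟩, rfl⟩
  change g • p ∈ _
  obtain ⟨hgQ, hgN, -⟩ := ovoidStabilizer_spec (Subgroup.commutator_le_self _ hg)
  refine ⟨(smul_mem_quadric (pencilForm_isometry c hgQ hgN)).2 hp, fun h => hpb ?_⟩
  rw [mem_baseLocus_iff_rep] at h ⊢
  obtain ⟨a, ha, hrep⟩ := exists_rep_smul g p
  have h2 := polarBilin_isometry (map_add g) hgQ N p.rep
  rw [hgN] at h2
  rwa [hrep, map_smul_form, hgQ, map_smul, h2, smul_eq_mul, mul_eq_zero, mul_eq_zero,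
    or_iff_right (pow_ne_zero 2 ha), or_iff_right ha] at h

/-- The intersection numbers of an orbit of the Suzuki group with the lines of an elliptic quadric
of the pencil. -/
theorem ncard_line_inter_suzukiOrbit [Finite F] [CharP F 2] (hV : finrank F V = 6)
    {Q : QuadraticForm F V} {N : V} (hN : Q N ≠ 0) {c : F} (hc : IsElliptic (pencilForm Q N c))
    {h : ℕ} (hh : 0 < h) (hq : Nat.card F = 2 ^ (2 * h + 1)) {T : Set (ℙ F V)}
    (hT : IsSuzukiTitsOvoid h Q N T) {A : Set (ℙ F V)}
    (hA : IsOrbitOn (suzukiGroup Q N T) (quadric (pencilForm Q N c) \ baseLocus Q N) A) {s : ℤ}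
    (hs : s ^ 2 = 2 * Nat.card F)
    (hAcard : 2 * (A.ncard : ℤ) =
      ((Nat.card F : ℤ) - 1) * (Nat.card F : ℤ) ^ 2 * (Nat.card F + 1 - s))
    {l : Submodule F V} (hl : IsPolarLine Q.polarBilin l)
    (hlQ : pointsOf l ⊆ quadric (pencilForm Q N c)) {P : ℙ F V}
    (hlP : pointsOf l ∩ baseLocus Q N = {P}) :
    (P ∈ T → 2 * ((pointsOf l ∩ A).ncard : ℤ) = Nat.card F) ∧
      (P ∉ T → 2 * ((pointsOf l ∩ A).ncard : ℤ) = Nat.card F - s) := by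
  have hpol := polarBilin_pencilForm Q N c
  have hB : Q.polarBilin.Nondegenerate := hpol ▸ hc.1
  obtain ⟨hTb, hTT, hTcard⟩ := hT.isOvoid hV hB hq
  have hG : ∀ g ∈ suzukiGroup Q N T, _ := fun g hg =>
    ovoidStabilizer_spec (Subgroup.commutator_le_self (ovoidStabilizer Q N T) hg)
  -- The quadric of parameter c takes over the role of Q: base locus, polar form and the value at N
  -- are unchanged, and the group preserves every form of the pencil.
  rw [← baseLocus_pencilForm Q N c] at hTb hA hlP
  rw [← hpol] at hTT hl
  refine ncard_line_inter_orbit hV hc (by rwa [pencilForm_self]) ?_ ?_ hs hTb hTT hTcard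
    (fun g hg => pencilForm_isometry c (hG g hg).1 (hG g hg).2.1) (fun g hg => (hG g hg).2.1)
    (fun g hg => (hG g hg).2.2) (hT.exists_smul_eq hV hB hq hh) hA hAcard hl hlQ hlP
  · rw [hq]
    calc 8 = 2 ^ 3 := by norm_num
      _ ≤ 2 ^ (2 * h + 1) := Nat.pow_le_pow_right (by norm_num) (by omega)
  · rw [hq, pow_succ]
    exact even_two.mul_left _

end Pencil

/-! ### The two constructions -/

theorem mainTheorem10 {F V : Type*} [Field F] [Finite F] [CharP F 2] [AddCommGroup V] [Module F V]
    (hV : finrank F V = 6) (q : ℕ) (hq : Nat.card F = q)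
    (B : LinearMap.BilinForm F V) (hBalt : B.IsAlt) (hB : B.Nondegenerate)
    (Q : QuadraticForm F V) (hQ : Q.polarBilin = B) (N : V) (hN : Q N ≠ 0)
    (cj ck : F) (hjk : cj ≠ ck)
    (hj : IsElliptic (pencilForm Q N cj)) (hk : IsElliptic (pencilForm Q N ck)) :
    (∀ Rj Rk : Set (ℙ F V),
      IsRelativeHemisystem (quadric (pencilForm Q N cj)) (baseLocus Q N) Rj →
      IsRelativeHemisystem (quadric (pencilForm Q N ck)) (baseLocus Q N) Rk →
      (∀ l : Submodule F V, IsPolarLine B l →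
        (pointsOf l ∩ (Rj ∪ Rk ∪ baseLocus Q N)).ncard ∈
          ({0, 1, 2, q / 2 + 1, q + 1} : Set ℕ)) ∧
      {l : Submodule F V | IsPolarLine B l ∧
        pointsOf l ⊆ Rj ∪ Rk ∪ baseLocus Q N}.ncard = (q + 1) * (q ^ 2 + 1)) ∧
    (∀ h : ℕ, 0 < h → q = 2 ^ (2 * h + 1) →
      ∀ T : Set (ℙ F V), IsSuzukiTitsOvoid h Q N T →
      ∀ Aj Bk : Set (ℙ F V),
      IsOrbitOn (suzukiGroup Q N T) (quadric (pencilForm Q N cj) \ baseLocus Q N) Aj →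
      (Aj.ncard : ℝ) = ((q : ℝ) ^ 3 - (q : ℝ) ^ 2) * ((q : ℝ) - √(2 * (q : ℝ)) + 1) / 2 →
      IsOrbitOn (suzukiGroup Q N T) (quadric (pencilForm Q N ck) \ baseLocus Q N) Bk →
      (Bk.ncard : ℝ) = ((q : ℝ) ^ 3 - (q : ℝ) ^ 2) * ((q : ℝ) + √(2 * (q : ℝ)) + 1) / 2 →
      (∀ l : Submodule F V, IsPolarLine B l →
        ((pointsOf l ∩ (Aj ∪ Bk ∪ baseLocus Q N)).ncard : ℝ) ∈
          ({0, 1, 2, ((q : ℝ) - √(2 * (q : ℝ))) / 2 + 1, (q : ℝ) / 2 + 1,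
            ((q : ℝ) + √(2 * (q : ℝ))) / 2 + 1, (q : ℝ) + 1} : Set ℝ) ∧
        (((pointsOf l ∩ (Aj ∪ Bk ∪ baseLocus Q N)).ncard : ℝ) = (q : ℝ) / 2 + 1 ↔
          (pointsOf l ⊆ quadric (pencilForm Q N cj) ∨
            pointsOf l ⊆ quadric (pencilForm Q N ck)) ∧
          ∃ t ∈ T, pointsOf l ∩ baseLocus Q N = {t})) ∧
      {l : Submodule F V | IsPolarLine B l ∧
        pointsOf l ⊆ Aj ∪ Bk ∪ baseLocus Q N}.ncard = (q + 1) * (q ^ 2 + 1)) := by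
  subst hQ hq
  have hq1 : 1 < Nat.card F := Finite.one_lt_card
  constructor
  · intro Rj Rk hRj hRk
    constructor
    · intro l hl
      rcases polarLine_inter_cases hjk hRj.1 hRk.1 hl with
        ⟨-, h⟩ | ⟨-, -, h⟩ | ⟨h1, h2, h⟩ | ⟨h1, h2, h⟩
      · simp [h]
      · generalize (pointsOf l ∩ (Rj ∪ Rk ∪ baseLocus Q N)).ncard = m at h ⊢
        interval_cases m <;> simp
      · have h3 := hRj.2.2 l hl.1 h1 h2
        rw [h]
        have h4 : (pointsOf l ∩ Rj).ncard = Nat.card F / 2 := by omega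
        simp [h4]
      · have h3 := hRk.2.2 l hl.1 h1 h2
        rw [h]
        have h4 : (pointsOf l ∩ Rk).ncard = Nat.card F / 2 := by omega
        simp [h4]
    · refine ncard_polarLines_subset hV hB hN hjk hRj.1 hRk.1 ?_ ?_
      · intro l hl h1 h2
        have h3 := hRj.2.2 l hl.1 h1 h2
        omega
      · intro l hl h1 h2
        have h3 := hRk.2.2 l hl.1 h1 h2
        omega
  · intro h hh hq T hT A A' hA hAcard hA' hA'card
    have hAsub := suzukiOrbit_subset hA
    have hA'sub := suzukiOrbit_subset hA'
    set q := Nat.card F with hqdef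
    obtain ⟨s, hs0, hs⟩ : ∃ s : ℤ, 0 < s ∧ s ^ 2 = 2 * q := by
      -- Since q is an odd power of 2, √(2q) is the integer 2^(h+1).
      refine ⟨2 ^ (h + 1), by positivity, ?_⟩
      rw [hq]
      push_cast
      ring
    have hq8 : 8 ≤ q := by
      rw [hq]
      calc 8 = 2 ^ 3 := by norm_num
        _ ≤ 2 ^ (2 * h + 1) := Nat.pow_le_pow_right (by norm_num) (by omega)
    -- Ensures (q + s)/2 < q, so that no line tangent to Q(4,q) is swallowed by the larger orbit.
    have hsq : s < q := by
      have : (8 : ℤ) ≤ q := by exact_mod_cast hq8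
      nlinarith
    have hsR : √(2 * (q : ℝ)) = s := by
      have h1 : (2 * q : ℝ) = (s : ℝ) ^ 2 := by exact_mod_cast hs.symm
      rw [h1, Real.sqrt_sq (by exact_mod_cast hs0.le)]
    rw [hsR] at hAcard hA'card ⊢
    have hAcard' : 2 * (A.ncard : ℤ) = ((q : ℤ) - 1) * (q : ℤ) ^ 2 * (q + 1 - s) := by
      have : 2 * (A.ncard : ℝ) = ((q : ℝ) - 1) * (q : ℝ) ^ 2 * (q + 1 - s) := by
        rw [hAcard]; ring
      exact_mod_cast this
    -- The larger orbit is the same situation with -s as the root of 2q.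
    have hA'card' : 2 * (A'.ncard : ℤ) = ((q : ℤ) - 1) * (q : ℤ) ^ 2 * (q + 1 - -s) := by
      have : 2 * (A'.ncard : ℝ) = ((q : ℝ) - 1) * (q : ℝ) ^ 2 * (q + 1 - -s) := by
        rw [hA'card]; ring
      exact_mod_cast this
    have hline : ∀ l, IsPolarLine Q.polarBilin l → ∀ P, pointsOf l ∩ baseLocus Q N = {P} →
        (pointsOf l ⊆ quadric (pencilForm Q N cj) →
          (P ∈ T ∧ 2 * ((pointsOf l ∩ A).ncard : ℤ) = q) ∨
            (P ∉ T ∧ 2 * ((pointsOf l ∩ A).ncard : ℤ) = q - s)) ∧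
        (pointsOf l ⊆ quadric (pencilForm Q N ck) →
          (P ∈ T ∧ 2 * ((pointsOf l ∩ A').ncard : ℤ) = q) ∨
            (P ∉ T ∧ 2 * ((pointsOf l ∩ A').ncard : ℤ) = q + s)) := by
      intro l hl P hP
      constructor
      · intro hlj
        have h1 := ncard_line_inter_suzukiOrbit hV hN hj hh hq hT hA hs hAcard' hl hlj hP
        by_cases hPT : P ∈ T
        · exact Or.inl ⟨hPT, h1.1 hPT⟩
        · exact Or.inr ⟨hPT, h1.2 hPT⟩
      · intro hlk
        have h1 := ncard_line_inter_suzukiOrbit hV hN hk hh hq hT hA' (s := -s)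
          (by rw [neg_sq, hs]) hA'card' hl hlk hP
        by_cases hPT : P ∈ T
        · exact Or.inl ⟨hPT, h1.1 hPT⟩
        · exact Or.inr ⟨hPT, by rw [h1.2 hPT, sub_neg_eq_add]⟩
    constructor
    · intro l hl
      rcases polarLine_inter_cases hjk hAsub hA'sub hl with
        ⟨h1, h2⟩ | ⟨h1, h2, h3⟩ | ⟨h1, h2, h3⟩ | ⟨h1, h2, h3⟩
      · rw [h2, ← hqdef]
        refine ⟨by push_cast; simp, ?_, ?_⟩
        · intro h4
          have h5 : (q : ℝ) = 0 := by push_cast at h4; linarith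
          have h6 : q = 0 := by exact_mod_cast h5
          omega
        · rintro ⟨-, t, -, ht⟩
          rw [Set.inter_eq_left.2 h1] at ht
          have h4 := ncard_pointsOf_of_finrank_two hl.1
          rw [ht, Set.ncard_singleton] at h4
          omega
      · refine ⟨?_, ?_, ?_⟩
        · generalize (pointsOf l ∩ (A ∪ A' ∪ baseLocus Q N)).ncard = m at h3 ⊢
          interval_cases m <;> simp
        -- At most two points cannot be q/2 + 1 points, because q ≥ 8.
        · intro h4
          have h5 : (8 : ℝ) ≤ q := by exact_mod_cast hq8
          have h6 : ((pointsOf l ∩ (A ∪ A' ∪ baseLocus Q N)).ncard : ℝ) ≤ 2 := by exact_mod_cast h3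
          linarith
        · rintro ⟨h4 | h4, -⟩
          · exact absurd h4 h1
          · exact absurd h4 h2
      · obtain ⟨P, hP⟩ := Set.ncard_eq_one.1 h2
        rw [h3, hP]
        rcases (hline l hl P hP).1 h1 with ⟨hPT, h4⟩ | ⟨hPT, h4⟩
        · have h5 : (((pointsOf l ∩ A).ncard + 1 : ℕ) : ℝ) = (q : ℝ) / 2 + 1 := by
            have h6 : 2 * ((pointsOf l ∩ A).ncard : ℝ) = q := by exact_mod_cast h4
            push_cast
            linarith
          exact ⟨by simp [h5], fun _ => ⟨Or.inl h1, P, hPT, rfl⟩, fun _ => h5⟩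
        · have h5 : (((pointsOf l ∩ A).ncard + 1 : ℕ) : ℝ) = ((q : ℝ) - s) / 2 + 1 := by
            have h6 : 2 * ((pointsOf l ∩ A).ncard : ℝ) = q - s := by exact_mod_cast h4
            push_cast
            linarith
          refine ⟨by simp [h5], fun h6 => ?_, ?_⟩
          · rw [h5] at h6
            have h7 : (s : ℝ) = 0 := by linarith
            exact absurd (by exact_mod_cast h7) hs0.ne'
          · rintro ⟨-, t, ht, hPt⟩
            exact absurd (Set.singleton_injective hPt ▸ ht) hPT
      · obtain ⟨P, hP⟩ := Set.ncard_eq_one.1 h2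
        rw [h3, hP]
        rcases (hline l hl P hP).2 h1 with ⟨hPT, h4⟩ | ⟨hPT, h4⟩
        · have h5 : (((pointsOf l ∩ A').ncard + 1 : ℕ) : ℝ) = (q : ℝ) / 2 + 1 := by
            have h6 : 2 * ((pointsOf l ∩ A').ncard : ℝ) = q := by exact_mod_cast h4
            push_cast
            linarith
          exact ⟨by simp [h5], fun _ => ⟨Or.inr h1, P, hPT, rfl⟩, fun _ => h5⟩
        · have h5 : (((pointsOf l ∩ A').ncard + 1 : ℕ) : ℝ) = ((q : ℝ) + s) / 2 + 1 := by
            have h6 : 2 * ((pointsOf l ∩ A').ncard : ℝ) = q + s := by exact_mod_cast h4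
            push_cast
            linarith
          refine ⟨by simp [h5], fun h6 => ?_, ?_⟩
          · rw [h5] at h6
            have h7 : (s : ℝ) = 0 := by linarith
            exact absurd (by exact_mod_cast h7) hs0.ne'
          · rintro ⟨-, t, ht, hPt⟩
            exact absurd (Set.singleton_injective hPt ▸ ht) hPT
    · refine ncard_polarLines_subset hV hB hN hjk hAsub hA'sub ?_ ?_
      · intro l hl h1 h2
        obtain ⟨P, hP⟩ := Set.ncard_eq_one.1 h2
        rcases (hline l hl P hP).1 h1 with ⟨-, h4⟩ | ⟨-, h4⟩ <;> omega
      · intro l hl h1 h2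
        obtain ⟨P, hP⟩ := Set.ncard_eq_one.1 h2
        rcases (hline l hl P hP).2 h1 with ⟨-, h4⟩ | ⟨-, h4⟩ <;> omega
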